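/- \textbf{Setting.} Let $\mathfrak d$ be a finite-dimensional real Lie algebra with an invariant non-degenerate symmetric pairing $\langle\cdot,\cdot\rangle$. Let $t\in(S^2\mathfrak d)^{\mathfrak d}$ be its inverse, $t^\sharp:\mathfrak d^*\to\mathfrak d$ the corresponding isomorphism, and $\phi\in\bigwedge^3\mathfrak d$, $\phi(\alpha,\beta,\gamma)=\frac14\langle[t^\sharp\alpha,t^\sharp\beta],\gamma\rangle$. A subspace $\mathfrak c\subset\mathfrak d$ is Lagrangian if $\mathfrak c^\perp=\mathfrak c$. We write $v\wedge w=v\otimes w-w\otimes v$. A \emph{$\mathfrak d$-quasi-Poisson manifold} is a smooth manifold $M$ with an action $\rho$ of $\mathfrak d$ (a Lie algebra homomorphism to smooth vector fields) and a $\mathfrak d$-invariant bivector field $\pi$ such that $\frac12[\pi,\pi]=\rho^{\otimes3}(\phi)$, where $[\cdot,\cdot]$ is the Schouten bracket (the one extending the Lie bracket of vector fields). Put $\sigma=\pi+\frac12\rho^{\otimes2}(t)$. The \emph{left leaves} of $M$ are the maximal connected integral manifolds (injectively immersed) of the distribution $T^LM=\{\sigma(\cdot,\alpha):\alpha\in T^*M\}$.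 The stabilizer of a left leaf $X$ is the Lie subalgebra of those $u\in\mathfrak d$ for which $\rho(u)$ is tangent to $X$. $M$ is \emph{split-symplectic} if at every point $\rho(\mathfrak d)+\{\pi(\alpha,\cdot):\alpha\in T^*M\}=TM$ and the stabilizers of all left leaves are Lagrangian. Let $\mathfrak h\subset\mathfrak d$ be a Lagrangian Lie subalgebra and $\mathfrak h^*\subset\mathfrak d$ a Lagrangian (vector space) complement of $\mathfrak h$, identified with the dual of $\mathfrak h$ by the pairing. For $\alpha,\beta,\gamma\in\mathfrak h^*$ and $u\in\mathfrak h$ let $\delta_{\mathfrak h}(u)(\alpha,\beta)=\langle u,[\alpha,\beta]\rangle$ and $\phi_{\mathfrak h}(\alpha,\beta,\gamma)=\langle[\alpha,\beta],\gamma\rangle$. An \emph{$(\mathfrak h,\mathfrak d;\mathfrak h^*)$-quasi-Poisson manifold} is a manifold $X$ with an action $\rho_X$ of $\mathfrak h$ and a bivector field $\pi_X$ such that $\frac12[\pi_X,\pi_X]=\rho_X^{\otimes3}(\phi_{\mathfrak h})$ and $[\rho_X(u),\pi_X]=-\rho_X^{\otimes2}(\delta_{\mathfrak h}(u))$ for all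 $u\in\mathfrak h$. It is \emph{quasi-symplectic} if it has just one quasi-symplectic leaf, i.e. if $X$ itself is a maximal connected integral manifold of the distribution $\rho_X(\mathfrak h)+\{\pi_X(\alpha,\cdot):\alpha\in T^*X\}$. \textbf{Theorem.} Let $(M,\rho,\pi)$ be a split-symplectic $\mathfrak d$-quasi-Poisson manifold, let $X\subset M$ be a left leaf, let $\mathfrak h\subset\mathfrak d$ be the stabilizer of $X$, and let $\mathfrak h^*\subset\mathfrak d$ be a Lagrangian complement of $\mathfrak h$. Let $e_i$ be a basis of $\mathfrak h$, $e^i$ the dual basis of $\mathfrak h^*$, and $\tau_{\mathfrak h,\mathfrak h^*}=\frac12\sum_i e_i\wedge e^i\in\bigwedge^2\mathfrak d$. Then the bivector field $$\pi'=\pi-\rho^{\otimes2}(\tau_{\mathfrak h,\mathfrak h^*})$$ is tangent to $X$, and $(X,\rho|_{\mathfrak h},\pi'|_X)$ is an $(\mathfrak h,\mathfrak d;\mathfrak h^*)$-quasi-symplectic manifold. -/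

import Mathlib

open scoped Manifold ContDiff

universe u

noncomputable section

namespace QuasiPoisson

/-! ### Linear algebra: contravariant tensors and pairings -/

section LinearAlgebra

variable {V W : Type*} [AddCommGroup V] [Module ℝ V] [AddCommGroup W] [Module ℝ W]

/-- Contravariant 2-tensors on a finite-dimensional space `V`, i.e. elements of `V ⊗ V`, regarded
as bilinear forms on the dual space. -/
abbrev Tensor2 (V : Type*) [AddCommGroup V] [Module ℝ V] : Type _ :=
  LinearMap.BilinForm ℝ (Module.Dual ℝ V)

/-- The decomposable tensor `v ⊗ w`, which sends `(α, β)` to `α v * β w`. -/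
def tmul (v w : V) : Tensor2 V :=
  (LinearMap.mul ℝ ℝ).compl₁₂ (Module.Dual.eval ℝ V v) (Module.Dual.eval ℝ V w)

/-- The bivector `v ∧ w = v ⊗ w - w ⊗ v`. -/
def wedge (v w : V) : Tensor2 V := tmul v w - tmul w v

/-- The push-forward `L^{⊗2} s` of a 2-tensor `s` by a linear map `L`. -/
def push (L : V →ₗ[ℝ] W) (s : Tensor2 V) : Tensor2 W :=
  LinearMap.compl₁₂ s L.dualMap L.dualMap

/-- The image of `V* → V`, `α ↦ s(·, α)`, for a 2-tensor `s` on a finite-dimensional space `V`. -/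
def imageRight (s : Tensor2 V) : Submodule ℝ V :=
  (LinearMap.range s.flip).comap (Module.Dual.eval ℝ V)

/-- The image of `V* → V`, `α ↦ s(α, ·)`, for a 2-tensor `s` on a finite-dimensional space `V`. -/
def imageLeft (s : Tensor2 V) : Submodule ℝ V :=
  (LinearMap.range s).comap (Module.Dual.eval ℝ V)

/-- A subspace `c` is Lagrangian for the pairing `B` if `c^⊥ = c`. -/
def IsLagrangian (B : LinearMap.BilinForm ℝ V) (c : Submodule ℝ V) : Prop :=
  B.orthogonal c = c

end LinearAlgebra

section Pairing

variable {𝔡 : Type*} [LieRing 𝔡] [LieAlgebra ℝ 𝔡]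

/-- `B` is a non-degenerate symmetric invariant pairing on the Lie algebra `𝔡`. -/
structure IsInvariantPairing (B : LinearMap.BilinForm ℝ 𝔡) : Prop where
  nondegenerate : B.Nondegenerate
  symm : B.IsSymm
  invariant : B.lieInvariant 𝔡

variable [FiniteDimensional ℝ 𝔡] {B : LinearMap.BilinForm ℝ 𝔡}

/-- The map `t^♯ : 𝔡* → 𝔡` given by the pairing, so that `B (t^♯ α) x = α x`. -/
def sharp (hB : IsInvariantPairing B) : Module.Dual ℝ 𝔡 →ₗ[ℝ] 𝔡 :=
  (B.toDual hB.nondegenerate).symm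

/-- The element `t ∈ S²𝔡` inverse to the pairing: `t(α, β) = β (t^♯ α)`. -/
def tTensor (hB : IsInvariantPairing B) : Tensor2 𝔡 :=
  (Module.Dual.eval ℝ 𝔡) ∘ₗ sharp hB

/-- The 3-vector `φ ∈ ⋀³𝔡`, `φ(α, β, γ) = ⟨[t^♯ α, t^♯ β], γ⟩ / 4`. -/
def phi (hB : IsInvariantPairing B) (α β γ : Module.Dual ℝ 𝔡) : ℝ :=
  (1 / 4) * γ ⁅sharp hB α, sharp hB β⁆

/-- If `k` is a Lagrangian complement of a subalgebra `𝔥 ⊆ 𝔡`, the pairing identifies `k` with the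
dual of `𝔥`. -/
theorem complement_bijective (hB : IsInvariantPairing B) (𝔥 : LieSubalgebra ℝ 𝔡)
    (k : Submodule ℝ 𝔡) (hk : IsLagrangian B k) (hc : IsCompl 𝔥.toSubmodule k) :
    Function.Bijective
      ((𝔥.toSubmodule.subtype.dualMap ∘ₗ B ∘ₗ k.subtype : k →ₗ[ℝ] Module.Dual ℝ 𝔥)) := by
  have iso : ∀ x ∈ k, ∀ y ∈ k, B x y = 0 := by
    intro x hx y hy
    have hy' : y ∈ B.orthogonal k := by rw [hk]; exact hy
    exact hy' x hx
  constructor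
  · rw [← LinearMap.ker_eq_bot, LinearMap.ker_eq_bot']
    intro x hx
    have h0 : ∀ y, B x y = 0 := by
      intro y
      obtain ⟨a, ha, b, hb, rfl⟩ := Submodule.mem_sup.1
        (show y ∈ 𝔥.toSubmodule ⊔ k by rw [hc.sup_eq_top]; trivial)
      have h1 : B x a = 0 := LinearMap.congr_fun hx (⟨a, ha⟩ : 𝔥)
      rw [map_add, h1, iso x x.2 b hb, add_zero]
    exact Subtype.ext (hB.nondegenerate.1 x h0)
  · intro α
    let p := Submodule.projectionOnto 𝔥.toSubmodule k hc
    let y : 𝔡 := sharp hB (α ∘ₗ p)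
    have hy : ∀ z, B y z = α (p z) := fun z =>
      LinearMap.BilinForm.apply_toDual_symm_apply (hB := hB.nondegenerate) (α ∘ₗ p) z
    have hyk : y ∈ k := by
      rw [← hk]
      intro z hz
      have : p z = 0 := Submodule.projectionOnto_apply_right hc ⟨z, hz⟩
      change B z y = 0
      rw [hB.symm.eq, hy, this, map_zero]
    refine ⟨⟨y, hyk⟩, LinearMap.ext fun z => ?_⟩
    have : p z = z := Submodule.projectionOnto_apply_left hc z
    change B y z = α z
    rw [hy, this]

/-- The data of a Lie algebra `𝔡` with an invariant non-degenerate symmetric pairing, a Lie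
subalgebra `𝔥 ⊆ 𝔡`, and a Lagrangian complement `k` of `𝔥`. -/
structure IsComplemented (B : LinearMap.BilinForm ℝ 𝔡) (𝔥 : LieSubalgebra ℝ 𝔡)
    (k : Submodule ℝ 𝔡) : Prop where
  pairing : IsInvariantPairing B
  lagrangian : IsLagrangian B k
  isCompl : IsCompl 𝔥.toSubmodule k

variable {𝔥 : LieSubalgebra ℝ 𝔡} {k : Submodule ℝ 𝔡}

/-- The identification of the dual of `𝔥` with the complement `k`: the element of `k` which
corresponds to `α` is the one with `B (toComplement α) u = α u` for all `u ∈ 𝔥`. -/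
def IsComplemented.toComplement (S : IsComplemented B 𝔥 k) : Module.Dual ℝ 𝔥 →ₗ[ℝ] 𝔡 :=
  k.subtype ∘ₗ (LinearEquiv.ofBijective _
    (complement_bijective S.pairing 𝔥 k S.lagrangian S.isCompl)).symm.toLinearMap

theorem IsComplemented.toComplement_mem (S : IsComplemented B 𝔥 k) (α : Module.Dual ℝ 𝔥) :
    S.toComplement α ∈ k :=
  Subtype.property _

theorem IsComplemented.pairing_toComplement (S : IsComplemented B 𝔥 k) (α : Module.Dual ℝ 𝔥)
    (u : 𝔥) : B (S.toComplement α) u = α u :=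
  LinearMap.congr_fun ((LinearEquiv.ofBijective _
    (complement_bijective S.pairing 𝔥 k S.lagrangian S.isCompl)).apply_symm_apply α) u

/-- The cobracket `δ_𝔥 : 𝔥 → ⋀²𝔥`, dual to the `k`-component of the bracket
`k ⊗ k → 𝔡 = 𝔥 ⊕ k`, where `k ≅ 𝔥*`. -/
def IsComplemented.delta (S : IsComplemented B 𝔥 k) (u : 𝔥) (α β : Module.Dual ℝ 𝔥) : ℝ :=
  B u ⁅S.toComplement α, S.toComplement β⁆

/-- The 3-vector `φ_𝔥 ∈ ⋀³𝔥` given by the `𝔥`-component of the bracket `k ⊗ k → 𝔡 = 𝔥 ⊕ k`,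
where `k ≅ 𝔥*`. -/
def IsComplemented.phi (S : IsComplemented B 𝔥 k) (α β γ : Module.Dual ℝ 𝔥) : ℝ :=
  B ⁅S.toComplement α, S.toComplement β⁆ (S.toComplement γ)

/-- The twist `τ_{𝔥,k} = ½ ∑ᵢ eᵢ ∧ eⁱ`, where `eᵢ` is a basis of `𝔥` and `eⁱ` is the dual basis of
the complement `k`. -/
def IsComplemented.twist (S : IsComplemented B 𝔥 k) {κ : Type*} [Fintype κ]
    (e : Module.Basis κ ℝ 𝔥) : Tensor2 𝔡 :=
  (1 / 2 : ℝ) • ∑ i, wedge (e i : 𝔡) (S.toComplement (e.coord i))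

end Pairing

/-! ### Bivector fields, Lie algebra actions -/

section Fields

variable {E : Type*} [NormedAddCommGroup E] [NormedSpace ℝ E]
  {M : Type*} [TopologicalSpace M] [ChartedSpace E M]

/-- The differential of a function, as an element of the algebraic dual of the tangent space. -/
def diff (f : M → ℝ) (x : M) : Module.Dual ℝ (TangentSpace 𝓘(ℝ, E) x) :=
  (mvfderiv 𝓘(ℝ, E) f x).toLinearMap

/-- The function `s(df, dg)` for a field of 2-tensors `s`. -/
def bracket (s : ∀ x : M, Tensor2 (TangentSpace 𝓘(ℝ, E) x)) (f g : M → ℝ) (x : M) : ℝ :=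
  s x (diff f x) (diff g x)

/-- The derivative `V f` of a function `f` along a vector field `V`. -/
def derivAlong (V : ∀ x : M, TangentSpace 𝓘(ℝ, E) x) (f : M → ℝ) (x : M) : ℝ :=
  diff f x (V x)

/-- `π` is a smooth bivector field. -/
structure IsBivectorField (π : ∀ x : M, Tensor2 (TangentSpace 𝓘(ℝ, E) x)) : Prop where
  alt : ∀ x, (π x).IsAlt
  smooth : ∀ f g : M → ℝ, ContMDiff 𝓘(ℝ, E) 𝓘(ℝ, ℝ) ∞ f → ContMDiff 𝓘(ℝ, E) 𝓘(ℝ, ℝ) ∞ g →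
    ContMDiff 𝓘(ℝ, E) 𝓘(ℝ, ℝ) ∞ (bracket π f g)

/-- The Schouten bracket `[π, π']` of two bivector fields, evaluated on `df, dg, dh`:
the Schouten bracket of the biderivations `π` and `π'` of the algebra of smooth functions. It
is normalized so that it extends the Lie bracket of vector fields, i.e.
`[X ∧ Y, X ∧ Y] = 2 [X, Y] ∧ X ∧ Y`. -/
def schouten (π π' : ∀ x : M, Tensor2 (TangentSpace 𝓘(ℝ, E) x)) (f g h : M → ℝ) (x : M) : ℝ :=
  (bracket π f (bracket π' g h) x + bracket π g (bracket π' h f) x +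
      bracket π h (bracket π' f g) x) +
    (bracket π' f (bracket π g h) x + bracket π' g (bracket π h f) x +
      bracket π' h (bracket π f g) x)

/-- The Schouten bracket `[V, π]` of a vector field and a bivector field (i.e. the Lie derivative
of `π` along `V`), evaluated on `df, dg`. -/
def lieDeriv (V : ∀ x : M, TangentSpace 𝓘(ℝ, E) x)
    (π : ∀ x : M, Tensor2 (TangentSpace 𝓘(ℝ, E) x)) (f g : M → ℝ) (x : M) : ℝ :=
  derivAlong V (bracket π f g) x - bracket π (derivAlong V f) g x - bracket π f (derivAlong V g) x

variable [IsManifold 𝓘(ℝ, E) ∞ M] {𝔤 : Type*} [LieRing 𝔤] [LieAlgebra ℝ 𝔤]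

/-- `ρ` is an action of the Lie algebra `𝔤` on `M`: a Lie algebra homomorphism from `𝔤` to the
smooth vector fields on `M`. -/
structure IsLieAction (ρ : ∀ x : M, 𝔤 →ₗ[ℝ] TangentSpace 𝓘(ℝ, E) x) : Prop where
  smooth : ∀ u : 𝔤, ContMDiff 𝓘(ℝ, E) 𝓘(ℝ, E).tangent ∞
    (fun x => (⟨x, ρ x u⟩ : TangentBundle 𝓘(ℝ, E) M))
  map_lie : ∀ (u v : 𝔤) (x : M),
    ρ x ⁅u, v⁆ = VectorField.mlieBracket 𝓘(ℝ, E) (fun y => ρ y u) (fun y => ρ y v) x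

end Fields

/-! ### Integral manifolds and leaves of distributions -/

section Leaves

variable {E : Type*} [NormedAddCommGroup E] [NormedSpace ℝ E]
  {M : Type u} [TopologicalSpace M] [ChartedSpace E M]

/-- The injectively immersed connected manifold `ι : X → M` is an integral manifold of the
distribution `D`, i.e. `T_x X = D_x` at each of its points `x`. -/
structure IsIntegralManifold (D : ∀ x : M, Submodule ℝ (TangentSpace 𝓘(ℝ, E) x))
    (n : ℕ) {X : Type u} [TopologicalSpace X] [ChartedSpace (EuclideanSpace ℝ (Fin n)) X]
    [IsManifold 𝓘(ℝ, EuclideanSpace ℝ (Fin n)) ∞ X] (ι : X → M) : Prop where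
  connected : ConnectedSpace X
  immersion : Manifold.IsImmersion 𝓘(ℝ, EuclideanSpace ℝ (Fin n)) 𝓘(ℝ, E) ∞ ι
  injective : Function.Injective ι
  tangent : ∀ x : X,
    LinearMap.range (mfderiv 𝓘(ℝ, EuclideanSpace ℝ (Fin n)) 𝓘(ℝ, E) ι x).toLinearMap = D (ι x)

/-- `ι : X → M` is a leaf of the distribution `D`, i.e. a maximal integral manifold. -/
structure IsLeaf (D : ∀ x : M, Submodule ℝ (TangentSpace 𝓘(ℝ, E) x))
    (n : ℕ) {X : Type u} [TopologicalSpace X] [ChartedSpace (EuclideanSpace ℝ (Fin n)) X]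
    [IsManifold 𝓘(ℝ, EuclideanSpace ℝ (Fin n)) ∞ X] (ι : X → M) : Prop
    extends IsIntegralManifold D n ι where
  maximal : ∀ (m : ℕ) (Y : Type u) [TopologicalSpace Y]
    [ChartedSpace (EuclideanSpace ℝ (Fin m)) Y]
    [IsManifold 𝓘(ℝ, EuclideanSpace ℝ (Fin m)) ∞ Y] (j : Y → M),
    IsIntegralManifold D m j → Set.range ι ⊆ Set.range j → Set.range j ⊆ Set.range ι

/-- The stabilizer of a submanifold `ι : X → M` with respect to an action `ρ`: the elements of the
Lie algebra which act by vector fields tangent to `X`. -/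
def stabilizer {𝔤 : Type*} [LieRing 𝔤] [LieAlgebra ℝ 𝔤]
    (ρ : ∀ x : M, 𝔤 →ₗ[ℝ] TangentSpace 𝓘(ℝ, E) x)
    (n : ℕ) {X : Type u} [TopologicalSpace X] [ChartedSpace (EuclideanSpace ℝ (Fin n)) X]
    (ι : X → M) : Submodule ℝ 𝔤 :=
  ⨅ x : X, (LinearMap.range
    (mfderiv 𝓘(ℝ, EuclideanSpace ℝ (Fin n)) 𝓘(ℝ, E) ι x).toLinearMap).comap (ρ (ι x))

end Leaves

/-! ### Quasi-Poisson manifolds -/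

section QuasiPoissonManifolds

variable {E : Type*} [NormedAddCommGroup E] [NormedSpace ℝ E]
  {M : Type u} [TopologicalSpace M] [ChartedSpace E M] [IsManifold 𝓘(ℝ, E) ∞ M]
  {𝔡 : Type*} [LieRing 𝔡] [LieAlgebra ℝ 𝔡] [FiniteDimensional ℝ 𝔡]
  {B : LinearMap.BilinForm ℝ 𝔡}

/-- `(M, ρ, π)` is a `𝔡`-quasi-Poisson manifold: `π` is a `𝔡`-invariant bivector field and
`[π, π] / 2 = ρ^{⊗3}(φ)`. -/
structure IsQuasiPoisson (hB : IsInvariantPairing B)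
    (ρ : ∀ x : M, 𝔡 →ₗ[ℝ] TangentSpace 𝓘(ℝ, E) x)
    (π : ∀ x : M, Tensor2 (TangentSpace 𝓘(ℝ, E) x)) : Prop where
  action : IsLieAction ρ
  bivector : IsBivectorField π
  invariant : ∀ (u : 𝔡) (f g : M → ℝ), ContMDiff 𝓘(ℝ, E) 𝓘(ℝ, ℝ) ∞ f →
    ContMDiff 𝓘(ℝ, E) 𝓘(ℝ, ℝ) ∞ g → ∀ x, lieDeriv (fun y => ρ y u) π f g x = 0
  schouten_eq : ∀ f g h : M → ℝ, ContMDiff 𝓘(ℝ, E) 𝓘(ℝ, ℝ) ∞ f →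
    ContMDiff 𝓘(ℝ, E) 𝓘(ℝ, ℝ) ∞ g → ContMDiff 𝓘(ℝ, E) 𝓘(ℝ, ℝ) ∞ h → ∀ x,
    schouten π π f g h x / 2 =
      phi hB ((ρ x).dualMap (diff f x)) ((ρ x).dualMap (diff g x)) ((ρ x).dualMap (diff h x))

/-- The tensor field `σ = π + ½ ρ^{⊗2}(t)`. -/
def sigma (hB : IsInvariantPairing B) (ρ : ∀ x : M, 𝔡 →ₗ[ℝ] TangentSpace 𝓘(ℝ, E) x)
    (π : ∀ x : M, Tensor2 (TangentSpace 𝓘(ℝ, E) x)) (x : M) :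
    Tensor2 (TangentSpace 𝓘(ℝ, E) x) :=
  π x + (1 / 2 : ℝ) • push (ρ x) (tTensor hB)

/-- The distribution `T^L M`, the image of `α ↦ σ(·, α)`. -/
def leftDistribution (hB : IsInvariantPairing B)
    (ρ : ∀ x : M, 𝔡 →ₗ[ℝ] TangentSpace 𝓘(ℝ, E) x)
    (π : ∀ x : M, Tensor2 (TangentSpace 𝓘(ℝ, E) x)) (x : M) :
    Submodule ℝ (TangentSpace 𝓘(ℝ, E) x) :=
  imageRight (sigma hB ρ π x)

/-- The distribution given by the image of `(u, α) ↦ ρ(u) + π(α, ·)`: `T^big M` for a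
quasi-Poisson manifold; its leaves are the quasi-symplectic leaves of an
`(𝔥, 𝔡; 𝔥*)`-quasi-Poisson manifold. -/
def bigDistribution {𝔤 : Type*} [LieRing 𝔤] [LieAlgebra ℝ 𝔤]
    (ρ : ∀ x : M, 𝔤 →ₗ[ℝ] TangentSpace 𝓘(ℝ, E) x)
    (π : ∀ x : M, Tensor2 (TangentSpace 𝓘(ℝ, E) x)) (x : M) :
    Submodule ℝ (TangentSpace 𝓘(ℝ, E) x) :=
  LinearMap.range (ρ x) ⊔ imageLeft (π x)

/-- A split-symplectic `𝔡`-quasi-Poisson manifold: `t` is non-degenerate (it is the inverse of the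
pairing `B`), `T^big M = TM`, and the stabilizers of the left leaves are Lagrangian. -/
structure IsSplitSymplectic (hB : IsInvariantPairing B)
    (ρ : ∀ x : M, 𝔡 →ₗ[ℝ] TangentSpace 𝓘(ℝ, E) x)
    (π : ∀ x : M, Tensor2 (TangentSpace 𝓘(ℝ, E) x)) : Prop
    extends IsQuasiPoisson hB ρ π where
  big : ∀ x, bigDistribution ρ π x = ⊤
  lagrangian : ∀ (n : ℕ) (Y : Type u) [TopologicalSpace Y]
    [ChartedSpace (EuclideanSpace ℝ (Fin n)) Y]
    [IsManifold 𝓘(ℝ, EuclideanSpace ℝ (Fin n)) ∞ Y] (j : Y → M),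
    IsLeaf (leftDistribution hB ρ π) n j → IsLagrangian B (stabilizer ρ n j)

variable {𝔥 : LieSubalgebra ℝ 𝔡} {k : Submodule ℝ 𝔡}

/-- `(X, ρ, π)` is an `(𝔥, 𝔡; k)`-quasi-Poisson manifold, where `k ≅ 𝔥*` is a Lagrangian complement
of the Lagrangian subalgebra `𝔥 ⊆ 𝔡`: `𝔥` acts on `X` by `ρ`, and the bivector field `π` satisfies
`[π, π] / 2 = ρ^{⊗3}(φ_𝔥)` and `[ρ(u), π] = -ρ^{⊗2}(δ_𝔥(u))` for `u ∈ 𝔥`. -/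
structure IsManinQuasiPoisson (S : IsComplemented B 𝔥 k)
    (ρ : ∀ x : M, 𝔥 →ₗ[ℝ] TangentSpace 𝓘(ℝ, E) x)
    (π : ∀ x : M, Tensor2 (TangentSpace 𝓘(ℝ, E) x)) : Prop where
  maninPair : IsLagrangian B 𝔥.toSubmodule
  action : IsLieAction ρ
  bivector : IsBivectorField π
  schouten_eq : ∀ f g h : M → ℝ, ContMDiff 𝓘(ℝ, E) 𝓘(ℝ, ℝ) ∞ f →
    ContMDiff 𝓘(ℝ, E) 𝓘(ℝ, ℝ) ∞ g → ContMDiff 𝓘(ℝ, E) 𝓘(ℝ, ℝ) ∞ h → ∀ x,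
    schouten π π f g h x / 2 =
      S.phi ((ρ x).dualMap (diff f x)) ((ρ x).dualMap (diff g x)) ((ρ x).dualMap (diff h x))
  lieDeriv_eq : ∀ (u : 𝔥) (f g : M → ℝ), ContMDiff 𝓘(ℝ, E) 𝓘(ℝ, ℝ) ∞ f →
    ContMDiff 𝓘(ℝ, E) 𝓘(ℝ, ℝ) ∞ g → ∀ x,
    lieDeriv (fun y => ρ y u) π f g x =
      -S.delta u ((ρ x).dualMap (diff f x)) ((ρ x).dualMap (diff g x))

/-- An `(𝔥, 𝔡; k)`-quasi-Poisson manifold is quasi-symplectic if it has just one quasi-symplectic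
leaf, i.e. if the whole manifold is a leaf of the distribution spanned by `ρ(𝔥)` and by the vectors
`π(α, ·)`. -/
structure IsQuasiSymplectic (n : ℕ) {X : Type u} [TopologicalSpace X]
    [ChartedSpace (EuclideanSpace ℝ (Fin n)) X]
    [IsManifold 𝓘(ℝ, EuclideanSpace ℝ (Fin n)) ∞ X] (S : IsComplemented B 𝔥 k)
    (ρ : ∀ x : X, 𝔥 →ₗ[ℝ] TangentSpace 𝓘(ℝ, EuclideanSpace ℝ (Fin n)) x)
    (π : ∀ x : X, Tensor2 (TangentSpace 𝓘(ℝ, EuclideanSpace ℝ (Fin n)) x)) : Prop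
    extends IsManinQuasiPoisson S ρ π where
  leaf : IsLeaf (bigDistribution ρ π) n (id : X → X)

/-- The twisted bivector field `π' = π - ρ^{⊗2}(τ_{𝔥,k})`. -/
def twisted (S : IsComplemented B 𝔥 k) {κ : Type*} [Fintype κ] (e : Module.Basis κ ℝ 𝔥)
    (ρ : ∀ x : M, 𝔡 →ₗ[ℝ] TangentSpace 𝓘(ℝ, E) x)
    (π : ∀ x : M, Tensor2 (TangentSpace 𝓘(ℝ, E) x)) (x : M) :
    Tensor2 (TangentSpace 𝓘(ℝ, E) x) :=
  π x - push (ρ x) (S.twist e)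

variable (n : ℕ) {X : Type u} [TopologicalSpace X] [ChartedSpace (EuclideanSpace ℝ (Fin n)) X]

/-- The bivector field `π` on `M` is tangent to the submanifold `ι : X → M`: at each point `x` of
`X` it lies in `⋀² T_x X ⊆ ⋀² T_x M`. -/
def IsTangent (ι : X → M) (π : ∀ x : M, Tensor2 (TangentSpace 𝓘(ℝ, E) x)) : Prop :=
  ∀ x : X, ∃ s : Tensor2 (TangentSpace 𝓘(ℝ, EuclideanSpace ℝ (Fin n)) x), s.IsAlt ∧
    push (mfderiv 𝓘(ℝ, EuclideanSpace ℝ (Fin n)) 𝓘(ℝ, E) ι x).toLinearMap s = π (ι x)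

/-- `πX` is the restriction `π|_X` of the bivector field `π` to the submanifold `ι : X → M`
(unique, since `ι` is an immersion). -/
def IsBivectorRestriction (ι : X → M) (π : ∀ x : M, Tensor2 (TangentSpace 𝓘(ℝ, E) x))
    (πX : ∀ x : X, Tensor2 (TangentSpace 𝓘(ℝ, EuclideanSpace ℝ (Fin n)) x)) : Prop :=
  ∀ x : X,
    push (mfderiv 𝓘(ℝ, EuclideanSpace ℝ (Fin n)) 𝓘(ℝ, E) ι x).toLinearMap (πX x) = π (ι x)

/-- `ρX` is the action of the subalgebra `𝔥` on the submanifold `ι : X → M` obtained by restricting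
the action `ρ` of `𝔡` on `M` (unique, since `ι` is an immersion). -/
def IsActionRestriction (ι : X → M) (ρ : ∀ x : M, 𝔡 →ₗ[ℝ] TangentSpace 𝓘(ℝ, E) x)
    (ρX : ∀ x : X, 𝔥 →ₗ[ℝ] TangentSpace 𝓘(ℝ, EuclideanSpace ℝ (Fin n)) x) : Prop :=
  ∀ (x : X) (u : 𝔥),
    mfderiv 𝓘(ℝ, EuclideanSpace ℝ (Fin n)) 𝓘(ℝ, E) ι x (ρX x u) = ρ (ι x) (u : 𝔡)

end QuasiPoissonManifolds

end QuasiPoisson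

end

/-! For `a` in the dual of `𝔡`, write `t^♯ a = p + q` with `p ∈ 𝔥` and `q ∈ 𝔥*`. Such a `p` exists
because `𝔥` is Lagrangian, and `q` corresponds to the restriction `a|_𝔥`. The twist then contracts
to `τ(a, ·) = (q - p) / 2`. This is `twistSharp`.

Tangency and transitivity have one source (`exists_sigma_apply_eq`): with `a` the pull-back of `α`
by `ρ`, `σ(·, α) = π'(·, α) + ρ(p)`. On the left leaf `X` both `σ(·, α)` and `ρ(p)` are tangent, so
`π'(·, α)` is tangent too, and by skew-symmetry `π'` lies in `⋀² TX`. Conversely, every vector of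
`TX` has the form `σ(·, α)`, so `ρ(𝔥)` and the image of `π'` span `TX`. As `X` is connected, it is
its own single quasi-symplectic leaf.

The two structure equations already hold on `M`, for the elements of `𝔥`. In `[π - τ, π - τ]` the
mixed term vanishes because `π` is `𝔡`-invariant; the Jacobiator of `τ` turns `φ` into `φ_𝔥`
(`phi_eq`), and `[ρ(u), τ]` is `δ_𝔥(u)` (`delta_eq`), both by expanding brackets of `p`'s and `q`'s.
The equations descend to `X` because each smooth function on `X` extends, near any given point of
`X`, to a smooth function on `M`. -/

noncomputable section

namespace QuasiPoisson

/-! ### Differentials of functions, and vector fields tested on global smooth functions. -/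

section Functions

variable {E : Type*} [NormedAddCommGroup E] [NormedSpace ℝ E]
  {M : Type*} [TopologicalSpace M] [ChartedSpace E M]

theorem diff_congr {f g : M → ℝ} {x : M} (h : f =ᶠ[nhds x] g) :
    diff (E := E) f x = diff g x := by
  ext v
  exact congrArg (fun L : E →L[ℝ] ℝ => L v) (h.mfderiv_eq (I := 𝓘(ℝ, E)) (I' := 𝓘(ℝ, ℝ)))

theorem diff_comp {E' : Type*} [NormedAddCommGroup E'] [NormedSpace ℝ E']
    {N : Type*} [TopologicalSpace N] [ChartedSpace E' N] {f : M → N} {g : N → ℝ} {x : M}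
    (hg : MDifferentiableAt 𝓘(ℝ, E') 𝓘(ℝ, ℝ) g (f x))
    (hf : MDifferentiableAt 𝓘(ℝ, E) 𝓘(ℝ, E') f x) :
    diff (E := E) (g ∘ f) x =
      (mfderiv 𝓘(ℝ, E) 𝓘(ℝ, E') f x).toLinearMap.dualMap (diff (E := E') g (f x)) := by
  ext v
  exact mvfderiv_comp_apply x hg hf v

theorem diff_add {f g : M → ℝ} {x : M} (hf : MDifferentiableAt 𝓘(ℝ, E) 𝓘(ℝ, ℝ) f x)
    (hg : MDifferentiableAt 𝓘(ℝ, E) 𝓘(ℝ, ℝ) g x) :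
    diff (E := E) (fun y => f y + g y) x = diff f x + diff g x := by
  ext v
  exact congrArg (fun L : TangentSpace 𝓘(ℝ, E) x →L[ℝ] ℝ => L v) (mvfderiv_add hf hg)

theorem diff_sub {f g : M → ℝ} {x : M} (hf : MDifferentiableAt 𝓘(ℝ, E) 𝓘(ℝ, ℝ) f x)
    (hg : MDifferentiableAt 𝓘(ℝ, E) 𝓘(ℝ, ℝ) g x) :
    diff (E := E) (fun y => f y - g y) x = diff f x - diff g x := by
  ext v
  exact congrArg (fun L : TangentSpace 𝓘(ℝ, E) x →L[ℝ] ℝ => L v) (mvfderiv_sub hf hg)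

theorem diff_mul {f g : M → ℝ} {x : M} (hf : MDifferentiableAt 𝓘(ℝ, E) 𝓘(ℝ, ℝ) f x)
    (hg : MDifferentiableAt 𝓘(ℝ, E) 𝓘(ℝ, ℝ) g x) :
    diff (E := E) (fun y => f y * g y) x = f x • diff g x + g x • diff f x := by
  ext v
  exact congrArg (fun L : TangentSpace 𝓘(ℝ, E) x →L[ℝ] ℝ => L v) (mvfderiv_mul hf hg)

theorem diff_const (c : ℝ) (x : M) : diff (E := E) (fun _ => c) x = 0 := by
  ext v
  exact congrArg (fun L : TangentSpace 𝓘(ℝ, E) x →L[ℝ] ℝ => L v)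
    (mvfderiv_const (I := 𝓘(ℝ, E)) (x := x) c)

theorem diff_const_mul (c : ℝ) {f : M → ℝ} {x : M}
    (hf : MDifferentiableAt 𝓘(ℝ, E) 𝓘(ℝ, ℝ) f x) :
    diff (E := E) (fun y => c * f y) x = c • diff f x := by
  rw [diff_mul mdifferentiableAt_const hf, diff_const, smul_zero, add_zero]

theorem diff_sum {κ : Type*} (s : Finset κ) {f : κ → M → ℝ} {x : M}
    (hf : ∀ i, ContMDiff 𝓘(ℝ, E) 𝓘(ℝ, ℝ) ∞ (f i)) :
    diff (E := E) (fun y => ∑ i ∈ s, f i y) x = ∑ i ∈ s, diff (f i) x := by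
  classical
  induction s using Finset.induction_on with
  | empty => simpa using diff_const (E := E) 0 x
  | insert a s ha ih =>
    simp only [Finset.sum_insert ha]
    rw [diff_add ((hf a).mdifferentiable (by simp) x)
      ((contMDiff_finsetSum fun i _ => hf i).mdifferentiable (by simp) x), ih]

theorem ContMDiff.derivAlong [IsManifold 𝓘(ℝ, E) ∞ M] {V : ∀ x : M, TangentSpace 𝓘(ℝ, E) x}
    (hV : ContMDiff 𝓘(ℝ, E) 𝓘(ℝ, E).tangent ∞
      (fun x => (⟨x, V x⟩ : TangentBundle 𝓘(ℝ, E) M)))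
    {f : M → ℝ} (hf : ContMDiff 𝓘(ℝ, E) 𝓘(ℝ, ℝ) ∞ f) :
    ContMDiff 𝓘(ℝ, E) 𝓘(ℝ, ℝ) ∞ (derivAlong V f) :=
  (contMDiff_snd_tangentBundle_modelSpace ℝ 𝓘(ℝ, ℝ)).comp
    ((hf.contMDiff_tangentMap (m := ∞) (by simp)).comp hV)

variable [FiniteDimensional ℝ E] [T2Space M] [IsManifold 𝓘(ℝ, E) ∞ M]

theorem exists_contMDiff_eventuallyEq {F : Type*} [NormedAddCommGroup F] [NormedSpace ℝ F]
    {U : Set M} (hU : IsOpen U) {p : M} (hp : p ∈ U)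
    {g : M → F} (hg : ContMDiffOn 𝓘(ℝ, E) 𝓘(ℝ, F) ∞ g U) :
    ∃ f : M → F, ContMDiff 𝓘(ℝ, E) 𝓘(ℝ, F) ∞ f ∧ f =ᶠ[nhds p] g := by
  obtain ⟨b, -, hb⟩ := (SmoothBumpFunction.nhds_basis_tsupport (I := 𝓘(ℝ, E)) p).mem_iff.1
    (hU.mem_nhds hp)
  refine ⟨fun x => b x • g x, contMDiff_of_tsupport fun x hx => ?_, ?_⟩
  · have hx' : x ∈ U := hb (tsupport_smul_subset_left _ _ hx)
    exact b.contMDiffAt.smul ((hg x hx').contMDiffAt (hU.mem_nhds hx'))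
  · filter_upwards [b.eventuallyEq_one] with x hx
    simp [hx]

theorem exists_contMDiff_eventuallyEq_extChartAt (p : M) :
    ∃ f : M → E, ContMDiff 𝓘(ℝ, E) 𝓘(ℝ, E) ∞ f ∧ f =ᶠ[nhds p] extChartAt 𝓘(ℝ, E) p :=
  exists_contMDiff_eventuallyEq (isOpen_extChartAt_source (I := 𝓘(ℝ, E)) p)
    (mem_extChartAt_source p)
    (by simpa only [extChartAt_source] using contMDiffOn_extChartAt (I := 𝓘(ℝ, E)) (x := p))

/-- Chart coordinates, cut off by a bump function, are global smooth functions, and linear forms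
composed with them separate tangent vectors. -/
theorem eq_of_forall_diff_eq {x : M} {v w : TangentSpace 𝓘(ℝ, E) x}
    (h : ∀ f : M → ℝ, ContMDiff 𝓘(ℝ, E) 𝓘(ℝ, ℝ) ∞ f → diff f x v = diff f x w) : v = w := by
  obtain ⟨c, hc, hcx⟩ := exists_contMDiff_eventuallyEq_extChartAt (E := E) x
  apply (isInvertible_mfderiv_extChartAt (I := 𝓘(ℝ, E)) (mem_extChartAt_source x)).injective
  rw [← hcx.mfderiv_eq]
  by_contra hne
  obtain ⟨l, hl⟩ := SeparatingDual.exists_separating_of_ne (R := ℝ) (V := E) hne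
  apply hl
  have := h (l ∘ c) (l.contDiff.contMDiff.comp hc)
  rw [diff_comp (E' := E) (l.contDiff.contMDiff.mdifferentiable (n := ∞) (by simp) _)
    (hc.mdifferentiable (by simp) x)] at this
  have hl' : diff (E := E) l (c x) = l.toLinearMap := by
    ext v
    exact congrArg (fun L : E →L[ℝ] ℝ => L v) (l.mfderiv_eq (x := c x))
  rw [hl'] at this
  exact this

/-- Near a point the components of `V` in the tangent trivialization are the derivatives along `V`
of the cut-off chart coordinates. -/
theorem contMDiff_of_forall_derivAlong {V : ∀ x : M, TangentSpace 𝓘(ℝ, E) x}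
    (h : ∀ f : M → ℝ, ContMDiff 𝓘(ℝ, E) 𝓘(ℝ, ℝ) ∞ f →
      ContMDiff 𝓘(ℝ, E) 𝓘(ℝ, ℝ) ∞ (derivAlong V f)) :
    ContMDiff 𝓘(ℝ, E) 𝓘(ℝ, E).tangent ∞
      (fun x => (⟨x, V x⟩ : TangentBundle 𝓘(ℝ, E) M)) := by
  intro x
  rw [Bundle.contMDiffAt_section]
  obtain ⟨c, hc, hcx⟩ := exists_contMDiff_eventuallyEq_extChartAt (E := E) x
  let b := Module.finBasis ℝ E
  have key : (fun y => (trivializationAt E (TangentSpace 𝓘(ℝ, E)) x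
      (⟨y, V y⟩ : TangentBundle 𝓘(ℝ, E) M)).2) =ᶠ[nhds x]
      fun y => ∑ i, derivAlong V ((b.coord i).toContinuousLinearMap ∘ c) y • b i := by
    filter_upwards [hcx.eventuallyEq_nhds, chart_source_mem_nhds E x] with y hy hys
    have h1 : (trivializationAt E (TangentSpace 𝓘(ℝ, E)) x
        (⟨y, V y⟩ : TangentBundle 𝓘(ℝ, E) M)).2 =
        mfderiv 𝓘(ℝ, E) 𝓘(ℝ, E) (extChartAt 𝓘(ℝ, E) x) y (V y) := by
      refine Eq.trans ?_ (congrArg (fun L : TangentSpace 𝓘(ℝ, E) y →L[ℝ] E => L (V y))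
        (TangentBundle.continuousLinearMapAt_trivializationAt hys))
      have hmem : y ∈ (trivializationAt E (TangentSpace 𝓘(ℝ, E)) x).baseSet := by simpa using hys
      exact ((congrFun (Bundle.Trivialization.continuousLinearMapAt_apply ℝ
          (trivializationAt E (TangentSpace 𝓘(ℝ, E)) x) (b := y)) (V y)).trans (congrFun
        (Bundle.Trivialization.coe_linearMapAt_of_mem (R := ℝ)
          (trivializationAt E (TangentSpace 𝓘(ℝ, E)) x) hmem) (V y))).symm
    rw [h1, ← hy.mfderiv_eq]
    refine (b.sum_repr _).symm.trans (Finset.sum_congr rfl fun i _ => ?_)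
    congr 1
    have hl : MDifferentiableAt 𝓘(ℝ, E) 𝓘(ℝ, ℝ) (b.coord i).toContinuousLinearMap (c y) :=
      (b.coord i).toContinuousLinearMap.contDiff.contMDiff.mdifferentiable (n := ∞) (by simp) _
    rw [derivAlong, diff_comp (E' := E) hl (hc.mdifferentiable (by simp) y)]
    exact congrArg (fun L : E →L[ℝ] ℝ => L (mfderiv 𝓘(ℝ, E) 𝓘(ℝ, E) c y (V y)))
      ((b.coord i).toContinuousLinearMap.mfderiv_eq (x := c y)).symm
  refine ContMDiffAt.congr_of_eventuallyEq ?_ key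
  refine ContMDiff.contMDiffAt (contMDiff_finsetSum fun i _ => ?_)
  exact (h _ ((b.coord i).toContinuousLinearMap.contDiff.contMDiff.comp hc)).smul contMDiff_const

end Functions

/-! ### The Lie bracket of vector fields as the commutator of derivations. -/

section LieBracket

variable {E : Type*} [NormedAddCommGroup E] [NormedSpace ℝ E]
  {M : Type*} [TopologicalSpace M] [ChartedSpace E M] [IsManifold 𝓘(ℝ, E) ∞ M]

theorem fderiv_comp_extChartAt_symm_mpullbackWithin (V : ∀ x : M, TangentSpace 𝓘(ℝ, E) x)
    {g : M → ℝ} (hg : ContMDiff 𝓘(ℝ, E) 𝓘(ℝ, ℝ) ∞ g) (x : M) {y : E}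
    (hy : y ∈ (extChartAt 𝓘(ℝ, E) x).target) :
    fderiv ℝ (g ∘ (extChartAt 𝓘(ℝ, E) x).symm) y
      (VectorField.mpullbackWithin 𝓘(ℝ, E) 𝓘(ℝ, E) (extChartAt 𝓘(ℝ, E) x).symm V
        (Set.range 𝓘(ℝ, E)) y) = derivAlong V g ((extChartAt 𝓘(ℝ, E) x).symm y) := by
  have hinv := isInvertible_mfderivWithin_extChartAt_symm (I := 𝓘(ℝ, E)) hy
  have hd : MDifferentiableAt 𝓘(ℝ, E) 𝓘(ℝ, E) (extChartAt 𝓘(ℝ, E) x).symm y := by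
    have := (contMDiffOn_extChartAt_symm (I := 𝓘(ℝ, E)) (n := ∞) x).contMDiffAt
      ((isOpen_extChartAt_target x).mem_nhds hy)
    exact this.mdifferentiableAt (by simp)
  have h1 := diff_comp (E := E) (E' := E) (hg.mdifferentiable (by simp) _) hd
  have h2 : fderiv ℝ (g ∘ (extChartAt 𝓘(ℝ, E) x).symm) y =
      mfderiv 𝓘(ℝ, E) 𝓘(ℝ, ℝ) (g ∘ (extChartAt 𝓘(ℝ, E) x).symm) y := mfderiv_eq_fderiv.symm
  have h3 : mfderivWithin 𝓘(ℝ, E) 𝓘(ℝ, E) (extChartAt 𝓘(ℝ, E) x).symm (Set.range 𝓘(ℝ, E)) y =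
      mfderiv 𝓘(ℝ, E) 𝓘(ℝ, E) (extChartAt 𝓘(ℝ, E) x).symm y := by
    rw [ModelWithCorners.range_eq_univ, mfderivWithin_univ]
  rw [h2]
  refine (congrArg (fun L : Module.Dual ℝ E => L (VectorField.mpullbackWithin 𝓘(ℝ, E) 𝓘(ℝ, E)
    (extChartAt 𝓘(ℝ, E) x).symm V (Set.range 𝓘(ℝ, E)) y)) h1).trans ?_
  refine congrArg (diff g _) ?_
  rw [VectorField.mpullbackWithin_apply]
  rw [h3] at hinv ⊢
  exact hinv.self_apply_inverse _

/-- In a chart this is the vector-space identity `VectorField.fderiv_apply_lieBracket`. The transfer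
needs the inner derivative to agree with its chart expression on a whole neighbourhood, since it is
differentiated again. -/
theorem diff_mlieBracket [CompleteSpace E] {V W : ∀ x : M, TangentSpace 𝓘(ℝ, E) x}
    (hV : ContMDiff 𝓘(ℝ, E) 𝓘(ℝ, E).tangent ∞
      (fun x => (⟨x, V x⟩ : TangentBundle 𝓘(ℝ, E) M)))
    (hW : ContMDiff 𝓘(ℝ, E) 𝓘(ℝ, E).tangent ∞
      (fun x => (⟨x, W x⟩ : TangentBundle 𝓘(ℝ, E) M)))
    {f : M → ℝ} (hf : ContMDiff 𝓘(ℝ, E) 𝓘(ℝ, ℝ) ∞ f) (x : M) :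
    diff f x (VectorField.mlieBracket 𝓘(ℝ, E) V W x) =
      derivAlong V (derivAlong W f) x - derivAlong W (derivAlong V f) x := by
  set φ := extChartAt 𝓘(ℝ, E) x
  have : IsManifold 𝓘(ℝ, E) 2 M := IsManifold.of_le (n := ∞) (by norm_cast)
  have hx : φ x ∈ φ.target := mem_extChartAt_target x
  have hxx : φ.symm (φ x) = x := extChartAt_to_inv x
  let P : (∀ x : M, TangentSpace 𝓘(ℝ, E) x) → E → E := fun U =>
    VectorField.mpullbackWithin 𝓘(ℝ, E) 𝓘(ℝ, E) φ.symm U (Set.range 𝓘(ℝ, E))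
  have key : ∀ (U : ∀ x : M, TangentSpace 𝓘(ℝ, E) x) (g : M → ℝ),
      ContMDiff 𝓘(ℝ, E) 𝓘(ℝ, ℝ) ∞ g → ∀ y ∈ φ.target,
      fderiv ℝ (g ∘ φ.symm) y (P U y) = derivAlong U g (φ.symm y) :=
    fun U g hg y hy => fderiv_comp_extChartAt_symm_mpullbackWithin U hg x hy
  have hsymm : ContMDiffAt 𝓘(ℝ, E) 𝓘(ℝ, E) ∞ φ.symm (φ x) :=
    (contMDiffOn_extChartAt_symm (I := 𝓘(ℝ, E)) (n := ∞) x).contMDiffAt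
      ((isOpen_extChartAt_target x).mem_nhds hx)
  have hcd : ∀ g : M → ℝ, ContMDiff 𝓘(ℝ, E) 𝓘(ℝ, ℝ) ∞ g →
      ContDiffAt ℝ ∞ (g ∘ φ.symm) (φ x) := fun g hg =>
    (hg.contMDiffAt.comp (φ x) hsymm).contDiffAt
  have hdP : ∀ U : ∀ x : M, TangentSpace 𝓘(ℝ, E) x,
      ContMDiff 𝓘(ℝ, E) 𝓘(ℝ, E).tangent ∞
        (fun x => (⟨x, U x⟩ : TangentBundle 𝓘(ℝ, E) M)) → DifferentiableAt ℝ (P U) (φ x) := by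
    intro U hU
    have := MDifferentiableWithinAt.differentiableWithinAt_mpullbackWithin_vectorField
      (hU.mdifferentiable (by simp) x).mdifferentiableWithinAt (s := Set.univ)
    exact this.differentiableAt (by simp)
  have hcomm : ∀ U U' : ∀ x : M, TangentSpace 𝓘(ℝ, E) x,
      ContMDiff 𝓘(ℝ, E) 𝓘(ℝ, E).tangent ∞
        (fun x => (⟨x, U' x⟩ : TangentBundle 𝓘(ℝ, E) M)) →
      fderiv ℝ (fun y => fderiv ℝ (f ∘ φ.symm) y (P U' y)) (φ x) (P U (φ x)) =
        derivAlong U (derivAlong U' f) x := by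
    intro U U' hU'
    have h1 : (fun y => fderiv ℝ (f ∘ φ.symm) y (P U' y)) =ᶠ[nhds (φ x)]
        derivAlong U' f ∘ φ.symm := by
      filter_upwards [(isOpen_extChartAt_target x).mem_nhds hx] with y hy
      exact key U' f hf y hy
    rw [h1.fderiv_eq, key U _ (ContMDiff.derivAlong hU' hf) _ hx, hxx]
  have hcalc := VectorField.fderiv_apply_lieBracket (hcd f hf) (n := ∞)
    (by rw [minSmoothness_of_isRCLikeNormedField]; norm_cast) (hdP W hW) (hdP V hV)
  rw [hcomm V W hW, hcomm W V hV] at hcalc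
  rw [← hcalc]
  have hφd : MDifferentiableAt 𝓘(ℝ, E) 𝓘(ℝ, E) φ x :=
    (contMDiffAt_extChartAt (I := 𝓘(ℝ, E)) (n := ∞)).mdifferentiableAt (by simp)
  have hfx : f =ᶠ[nhds x] (f ∘ φ.symm) ∘ φ := by
    filter_upwards [extChartAt_source_mem_nhds (I := 𝓘(ℝ, E)) x] with y hy
    simp [φ.left_inv hy]
  rw [diff_congr hfx, diff_comp (E' := E)
    ((hcd f hf).contMDiffAt.mdifferentiableAt (n := ∞) (by simp)) hφd]
  have h4 : mfderiv 𝓘(ℝ, E) 𝓘(ℝ, E) φ x (VectorField.mlieBracket 𝓘(ℝ, E) V W x) =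
      VectorField.lieBracket ℝ (P V) (P W) (φ x) := by
    rw [← VectorField.mlieBracketWithin_univ, VectorField.mlieBracketWithin_apply]
    refine ((isInvertible_mfderiv_extChartAt (I := 𝓘(ℝ, E))
      (mem_extChartAt_source x)).self_apply_inverse _).trans ?_
    have hset : φ.symm ⁻¹' Set.univ ∩ Set.range 𝓘(ℝ, E) = Set.univ := by simp
    exact (congrArg (fun s => VectorField.lieBracketWithin ℝ (P V) (P W) s (φ x)) hset).trans
      (congrFun VectorField.lieBracketWithin_univ (φ x))
  refine (congrArg (diff (E := E) (f ∘ φ.symm) (φ x)) h4).trans ?_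
  exact congrArg (fun L : E →L[ℝ] ℝ => L (VectorField.lieBracket ℝ (P V) (P W) (φ x)))
    mfderiv_eq_fderiv

end LieBracket

/-! ### Linear algebra of the twist for a Lagrangian splitting. -/

section Twist

variable {𝔡 : Type*} [LieRing 𝔡] [LieAlgebra ℝ 𝔡]
  {B : LinearMap.BilinForm ℝ 𝔡} {𝔥 : LieSubalgebra ℝ 𝔡} {k : Submodule ℝ 𝔡}

theorem IsInvariantPairing.pairing_comm (hB : IsInvariantPairing B) (x y : 𝔡) :
    B x y = B y x :=
  hB.symm.eq x y

theorem IsInvariantPairing.pairing_lie_cycle (hB : IsInvariantPairing B) (x y z : 𝔡) :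
    B x ⁅y, z⁆ = B z ⁅x, y⁆ := by
  have h := hB.invariant y x z
  rw [hB.pairing_comm z, ← lie_skew x y, map_neg, LinearMap.neg_apply, h, neg_neg]

variable [FiniteDimensional ℝ 𝔡]

theorem pairing_sharp (hB : IsInvariantPairing B) (a : Module.Dual ℝ 𝔡) (x : 𝔡) :
    B (sharp hB a) x = a x :=
  LinearMap.BilinForm.apply_toDual_symm_apply (hB := hB.nondegenerate) a x

theorem IsLagrangian.pairing_eq_zero {V : Type*} [AddCommGroup V] [Module ℝ V]
    {B : LinearMap.BilinForm ℝ V} {c : Submodule ℝ V} (hc : IsLagrangian B c) {x y : V}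
    (hx : x ∈ c) (hy : y ∈ c) : B x y = 0 := by
  rw [← hc] at hy
  exact hy x hx

theorem IsLagrangian.mem_of_forall {V : Type*} [AddCommGroup V] [Module ℝ V]
    {B : LinearMap.BilinForm ℝ V} {c : Submodule ℝ V} (hc : IsLagrangian B c) {y : V}
    (hy : ∀ x ∈ c, B x y = 0) : y ∈ c := by
  rw [← hc]
  exact hy

/-- The restriction of a linear form on `𝔡` to the subalgebra `𝔥`. -/
def restrictForm (𝔥 : LieSubalgebra ℝ 𝔡) : Module.Dual ℝ 𝔡 →ₗ[ℝ] Module.Dual ℝ 𝔥 :=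
  𝔥.toSubmodule.subtype.dualMap

/-- Both terms pair with `𝔥` as `a|_𝔥` does, so the difference lies in `𝔥^⊥ = 𝔥`. This is the
component `p` of `t^♯ a`. -/
theorem IsComplemented.sharp_sub_toComplement_mem (S : IsComplemented B 𝔥 k)
    (h𝔥 : IsLagrangian B 𝔥.toSubmodule) (a : Module.Dual ℝ 𝔡) :
    sharp S.pairing a - S.toComplement (restrictForm 𝔥 a) ∈ 𝔥 := by
  refine h𝔥.mem_of_forall fun u hu => ?_
  rw [S.pairing.pairing_comm, map_sub, LinearMap.sub_apply, pairing_sharp,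
    S.pairing_toComplement (restrictForm 𝔥 a) ⟨u, hu⟩]
  exact sub_self _

/-- The map `𝔡* → 𝔡`, `a ↦ τ(a, ·)`, for the twist `τ`. -/
def IsComplemented.twistSharp (S : IsComplemented B 𝔥 k) : Module.Dual ℝ 𝔡 →ₗ[ℝ] 𝔡 :=
  S.toComplement ∘ₗ restrictForm 𝔥 - (1 / 2 : ℝ) • sharp S.pairing

variable {κ : Type*} [Fintype κ]

theorem IsComplemented.toComplement_restrictForm (S : IsComplemented B 𝔥 k)
    (e : Module.Basis κ ℝ 𝔥) (a : Module.Dual ℝ 𝔡) :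
    S.toComplement (restrictForm 𝔥 a) = ∑ i, a (e i) • S.toComplement (e.coord i) := by
  have : restrictForm 𝔥 a = ∑ i, a (e i) • e.coord i := by
    refine e.ext fun j => ?_
    classical
    simp [restrictForm, Finsupp.single_apply]
    rfl
  simp only [this, map_sum, map_smul]

theorem IsComplemented.sharp_sub_toComplement (S : IsComplemented B 𝔥 k)
    (h𝔥 : IsLagrangian B 𝔥.toSubmodule) (e : Module.Basis κ ℝ 𝔥) (a : Module.Dual ℝ 𝔡) :
    sharp S.pairing a - S.toComplement (restrictForm 𝔥 a) =
      ∑ i, a (S.toComplement (e.coord i)) • (e i : 𝔡) := by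
  let p : 𝔥 := ⟨_, S.sharp_sub_toComplement_mem h𝔥 a⟩
  have hp : p = ∑ i, a (S.toComplement (e.coord i)) • e i := by
    refine (e.sum_repr p).symm.trans (Finset.sum_congr rfl fun i _ => ?_)
    congr 1
    -- The `i`-th coordinate of `p` is `⟨eⁱ, p⟩`, which equals `⟨eⁱ, t^♯ a⟩ = a(eⁱ)` because `k` is
    -- isotropic.
    have h1 := S.pairing_toComplement (e.coord i) p
    rw [Module.Basis.coord_apply] at h1
    rw [← h1, map_sub, S.lagrangian.pairing_eq_zero (S.toComplement_mem _) (S.toComplement_mem _),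
      sub_zero, S.pairing.pairing_comm, pairing_sharp]
  have := congrArg (Subtype.val : 𝔥 → 𝔡) hp
  simpa [p] using this

theorem IsComplemented.twistSharp_eq_sum (S : IsComplemented B 𝔥 k)
    (h𝔥 : IsLagrangian B 𝔥.toSubmodule) (e : Module.Basis κ ℝ 𝔥) (a : Module.Dual ℝ 𝔡) :
    S.twistSharp a = (1 / 2 : ℝ) • ∑ i, (a (e i) • S.toComplement (e.coord i) -
      a (S.toComplement (e.coord i)) • (e i : 𝔡)) := by
  rw [Finset.sum_sub_distrib, ← S.toComplement_restrictForm e, ← S.sharp_sub_toComplement h𝔥 e]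
  simp only [twistSharp, LinearMap.sub_apply, LinearMap.comp_apply, LinearMap.smul_apply]
  module

theorem IsComplemented.twist_apply (S : IsComplemented B 𝔥 k) (e : Module.Basis κ ℝ 𝔥)
    (a b : Module.Dual ℝ 𝔡) :
    S.twist e a b = (1 / 2 : ℝ) * ∑ i, (a (e i) * b (S.toComplement (e.coord i)) -
      a (S.toComplement (e.coord i)) * b (e i)) := by
  simp [twist, wedge, tmul, LinearMap.sum_apply]

theorem IsComplemented.twist_eq_apply_twistSharp (S : IsComplemented B 𝔥 k)
    (h𝔥 : IsLagrangian B 𝔥.toSubmodule) (e : Module.Basis κ ℝ 𝔥) (a b : Module.Dual ℝ 𝔡) :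
    S.twist e a b = b (S.twistSharp a) := by
  rw [S.twist_apply, S.twistSharp_eq_sum h𝔥 e]
  simp [map_sum]

theorem IsComplemented.twist_swap (S : IsComplemented B 𝔥 k) (e : Module.Basis κ ℝ 𝔥)
    (a b : Module.Dual ℝ 𝔡) : S.twist e a b = -S.twist e b a := by
  rw [S.twist_apply, S.twist_apply, ← mul_neg, ← Finset.sum_neg_distrib]
  congr 1
  exact Finset.sum_congr rfl fun i _ => by ring

theorem IsComplemented.exists_decomposition (S : IsComplemented B 𝔥 k)
    (h𝔥 : IsLagrangian B 𝔥.toSubmodule) (a : Module.Dual ℝ 𝔡) :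
    ∃ p ∈ 𝔥, sharp S.pairing a = p + S.toComplement (restrictForm 𝔥 a) ∧
      S.twistSharp a = (1 / 2 : ℝ) • (S.toComplement (restrictForm 𝔥 a) - p) := by
  refine ⟨_, S.sharp_sub_toComplement_mem h𝔥 a, (sub_add_cancel _ _).symm, ?_⟩
  simp only [twistSharp, LinearMap.sub_apply, LinearMap.comp_apply, LinearMap.smul_apply]
  module

/-- By invariance the left side is `½⟨u, [q_a - p_a, q_b + p_b] + [q_a + p_a, q_b - p_b]⟩ = ⟨u,
[q_a, q_b] - [p_a, p_b]⟩`. The last bracket contributes nothing because `𝔥` is an isotropic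
subalgebra. -/
theorem IsComplemented.delta_eq (S : IsComplemented B 𝔥 k)
    (h𝔥 : IsLagrangian B 𝔥.toSubmodule) (u : 𝔥) (a b : Module.Dual ℝ 𝔡) :
    b ⁅(u : 𝔡), S.twistSharp a⁆ - a ⁅(u : 𝔡), S.twistSharp b⁆ =
      S.delta u (restrictForm 𝔥 a) (restrictForm 𝔥 b) := by
  obtain ⟨pa, hpa, ha, hTa⟩ := S.exists_decomposition h𝔥 a
  obtain ⟨pb, hpb, hb, hTb⟩ := S.exists_decomposition h𝔥 b
  have h0 : B u ⁅pa, pb⁆ = 0 := h𝔥.pairing_eq_zero u.2 (𝔥.lie_mem hpa hpb)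
  have hc := S.pairing.pairing_lie_cycle
  rw [delta, ← pairing_sharp S.pairing b, ← pairing_sharp S.pairing a,
    hc (sharp S.pairing b) u, hc (S.twistSharp a), hc (sharp S.pairing a) u,
    hc (S.twistSharp b), ← lie_skew (S.twistSharp b), hTa, hTb, ha, hb]
  simp only [map_add, map_sub, map_neg, map_smul, lie_add, add_lie, lie_sub, sub_lie, lie_smul,
    smul_lie, smul_eq_mul, h0]
  ring

/-- Each of the four terms expands with coefficients `±1/4` in the triple products `⟨[x_a, x_b],
x_c⟩`, where each `x` is a `p` or a `q`. Those mixing `p` and `q` carry two signs of each kind and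
cancel; the one in `q` alone gets `4 · 1/4 = 1`; the one in `p` alone is zero because `𝔥` is an
isotropic subalgebra. -/
theorem IsComplemented.phi_eq (S : IsComplemented B 𝔥 k)
    (h𝔥 : IsLagrangian B 𝔥.toSubmodule) (a b c : Module.Dual ℝ 𝔡) :
    QuasiPoisson.phi S.pairing a b c + (c ⁅S.twistSharp a, S.twistSharp b⁆ +
      a ⁅S.twistSharp b, S.twistSharp c⁆ + b ⁅S.twistSharp c, S.twistSharp a⁆) =
      S.phi (restrictForm 𝔥 a) (restrictForm 𝔥 b) (restrictForm 𝔥 c) := by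
  obtain ⟨pa, hpa, ha, hTa⟩ := S.exists_decomposition h𝔥 a
  obtain ⟨pb, hpb, hb, hTb⟩ := S.exists_decomposition h𝔥 b
  obtain ⟨pc, hpc, hc', hTc⟩ := S.exists_decomposition h𝔥 c
  have h0 : B pc ⁅pa, pb⁆ = 0 := h𝔥.pairing_eq_zero hpc (𝔥.lie_mem hpa hpb)
  have hc := S.pairing.pairing_lie_cycle
  rw [phi, QuasiPoisson.phi, S.pairing.pairing_comm ⁅_, _⁆, ← pairing_sharp S.pairing a,
    ← pairing_sharp S.pairing b, ← pairing_sharp S.pairing c, ← pairing_sharp S.pairing c,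
    hc (sharp S.pairing a), hc (sharp S.pairing b), hc (S.twistSharp a), hTa, hTb, hTc, ha, hb, hc']
  simp only [map_add, map_sub, map_smul, lie_add, add_lie, lie_sub, sub_lie, lie_smul,
    smul_lie, smul_eq_mul, LinearMap.add_apply, LinearMap.sub_apply, LinearMap.smul_apply, h0]
  ring

end Twist

/-! ### Lie algebra actions as derivations of functions. -/

section Schouten

variable {E : Type*} [NormedAddCommGroup E] [NormedSpace ℝ E]
  {M : Type u} [TopologicalSpace M] [ChartedSpace E M] [IsManifold 𝓘(ℝ, E) ∞ M]

omit [IsManifold 𝓘(ℝ, E) ∞ M] in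
theorem IsBivectorField.bracket_swap {π : ∀ x : M, Tensor2 (TangentSpace 𝓘(ℝ, E) x)}
    (hπ : IsBivectorField π) (f g : M → ℝ) (x : M) : bracket π f g x = -bracket π g f x :=
  ((hπ.alt x).neg_eq _ _).symm

variable {𝔤 : Type*} [LieRing 𝔤] [LieAlgebra ℝ 𝔤]
  {ρ : ∀ x : M, 𝔤 →ₗ[ℝ] TangentSpace 𝓘(ℝ, E) x}

theorem IsLieAction.contMDiff_derivAlong (hρ : IsLieAction ρ) (u : 𝔤) {f : M → ℝ}
    (hf : ContMDiff 𝓘(ℝ, E) 𝓘(ℝ, ℝ) ∞ f) :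
    ContMDiff 𝓘(ℝ, E) 𝓘(ℝ, ℝ) ∞ (derivAlong (fun y => ρ y u) f) :=
  ContMDiff.derivAlong (hρ.smooth u) hf

theorem IsLieAction.derivAlong_lie [CompleteSpace E] (hρ : IsLieAction ρ) (u v : 𝔤) {f : M → ℝ}
    (hf : ContMDiff 𝓘(ℝ, E) 𝓘(ℝ, ℝ) ∞ f) (x : M) :
    diff f x (ρ x ⁅u, v⁆) = derivAlong (fun y => ρ y u) (derivAlong (fun y => ρ y v) f) x -
      derivAlong (fun y => ρ y v) (derivAlong (fun y => ρ y u) f) x := by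
  rw [hρ.map_lie]
  exact diff_mlieBracket (hρ.smooth u) (hρ.smooth v) hf x

/-- The linear map `u ↦ d(ρ(u) f)` at a point. -/
def IsLieAction.diffDerivAlong (hρ : IsLieAction ρ) {f : M → ℝ}
    (hf : ContMDiff 𝓘(ℝ, E) 𝓘(ℝ, ℝ) ∞ f) (x : M) :
    𝔤 →ₗ[ℝ] Module.Dual ℝ (TangentSpace 𝓘(ℝ, E) x) where
  toFun u := diff (derivAlong (fun y => ρ y u) f) x
  map_add' u v := by
    rw [← diff_add ((hρ.contMDiff_derivAlong u hf).mdifferentiable (by simp) x)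
      ((hρ.contMDiff_derivAlong v hf).mdifferentiable (by simp) x)]
    congr 1
    ext y
    simp [derivAlong]
  map_smul' c u := by
    rw [RingHom.id_apply,
      ← diff_const_mul c ((hρ.contMDiff_derivAlong u hf).mdifferentiable (by simp) x)]
    congr 1
    ext y
    simp [derivAlong]

end Schouten

/-! ### The structure equations of the twisted bivector field on the ambient manifold. -/

section TwistedBracket

variable {E : Type*} [NormedAddCommGroup E] [NormedSpace ℝ E]
  {M : Type u} [TopologicalSpace M] [ChartedSpace E M] [IsManifold 𝓘(ℝ, E) ∞ M]
  {𝔡 : Type*} [LieRing 𝔡] [LieAlgebra ℝ 𝔡] [FiniteDimensional ℝ 𝔡]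
  {B : LinearMap.BilinForm ℝ 𝔡} {𝔥 : LieSubalgebra ℝ 𝔡} {k : Submodule ℝ 𝔡}
  {ρ : ∀ x : M, 𝔡 →ₗ[ℝ] TangentSpace 𝓘(ℝ, E) x}
  {π : ∀ x : M, Tensor2 (TangentSpace 𝓘(ℝ, E) x)}
  {κ : Type*} [Fintype κ]

/-- The pull-back to `𝔡` of the differential of a function by the action. -/
def moment (ρ : ∀ x : M, 𝔡 →ₗ[ℝ] TangentSpace 𝓘(ℝ, E) x) (f : M → ℝ) (x : M) :
    Module.Dual ℝ 𝔡 :=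
  (ρ x).dualMap (diff f x)

omit [IsManifold 𝓘(ℝ, E) ∞ M] [FiniteDimensional ℝ 𝔡] in
theorem moment_apply (f : M → ℝ) (x : M) (u : 𝔡) :
    moment ρ f x u = derivAlong (fun y => ρ y u) f x := rfl

/-- The bracket of functions given by the push-forward of the twist. -/
def twistBracket (S : IsComplemented B 𝔥 k) (e : Module.Basis κ ℝ 𝔥)
    (ρ : ∀ x : M, 𝔡 →ₗ[ℝ] TangentSpace 𝓘(ℝ, E) x) (f g : M → ℝ) (x : M) : ℝ :=
  bracket (fun y => push (ρ y) (S.twist e)) f g x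

variable (S : IsComplemented B 𝔥 k) (e : Module.Basis κ ℝ 𝔥)

omit [IsManifold 𝓘(ℝ, E) ∞ M] in
theorem bracket_twisted (f g : M → ℝ) :
    bracket (twisted S e ρ π) f g =
      fun x => bracket π f g x - twistBracket S e ρ f g x := rfl

omit [IsManifold 𝓘(ℝ, E) ∞ M] in
theorem twistBracket_eq_twist (f g : M → ℝ) (x : M) :
    twistBracket S e ρ f g x = S.twist e (moment ρ f x) (moment ρ g x) := rfl

omit [IsManifold 𝓘(ℝ, E) ∞ M] in
theorem twistBracket_swap (f g : M → ℝ) (x : M) :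
    twistBracket S e ρ f g x = -twistBracket S e ρ g f x :=
  S.twist_swap e _ _

omit [IsManifold 𝓘(ℝ, E) ∞ M] in
theorem twistBracket_eq_sum (f g : M → ℝ) :
    twistBracket S e ρ f g = fun x => (1 / 2 : ℝ) * ∑ i,
      (derivAlong (fun y => ρ y (e i : 𝔡)) f x *
          derivAlong (fun y => ρ y (S.toComplement (e.coord i))) g x -
        derivAlong (fun y => ρ y (S.toComplement (e.coord i))) f x *
          derivAlong (fun y => ρ y (e i : 𝔡)) g x) := by
  ext x
  rw [twistBracket_eq_twist, S.twist_apply]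
  rfl

theorem contMDiff_twistBracket (hρ : IsLieAction ρ) {f g : M → ℝ}
    (hf : ContMDiff 𝓘(ℝ, E) 𝓘(ℝ, ℝ) ∞ f) (hg : ContMDiff 𝓘(ℝ, E) 𝓘(ℝ, ℝ) ∞ g) :
    ContMDiff 𝓘(ℝ, E) 𝓘(ℝ, ℝ) ∞ (twistBracket S e ρ f g) := by
  rw [twistBracket_eq_sum]
  refine contMDiff_const.mul (contMDiff_finsetSum fun i _ => ContMDiff.sub ?_ ?_) <;>
    exact (hρ.contMDiff_derivAlong _ hf).mul (hρ.contMDiff_derivAlong _ hg)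

variable (h𝔥 : IsLagrangian B 𝔥.toSubmodule)
include h𝔥

omit [IsManifold 𝓘(ℝ, E) ∞ M] in
theorem twistBracket_eq_derivAlong (f g : M → ℝ) (x : M) :
    twistBracket S e ρ f g x =
      derivAlong (fun y => ρ y (S.twistSharp (moment ρ f x))) g x :=
  S.twist_eq_apply_twistSharp h𝔥 e _ _

/-- By the Leibniz rule, one half of the terms differentiates `g` with the coefficients from `f`
frozen at `x`, and the other half does the reverse. The frozen coefficients are constant elements of
`𝔡`, so iterated brackets become iterated derivatives along fields of the action. -/
theorem diff_twistBracket (hρ : IsLieAction ρ) {f g : M → ℝ}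
    (hf : ContMDiff 𝓘(ℝ, E) 𝓘(ℝ, ℝ) ∞ f) (hg : ContMDiff 𝓘(ℝ, E) 𝓘(ℝ, ℝ) ∞ g) (x : M) :
    diff (E := E) (twistBracket S e ρ f g) x =
      diff (derivAlong (fun y => ρ y (S.twistSharp (moment ρ f x))) g) x -
        diff (derivAlong (fun y => ρ y (S.twistSharp (moment ρ g x))) f) x := by
  have hd : ∀ (u : 𝔡) {f : M → ℝ}, ContMDiff 𝓘(ℝ, E) 𝓘(ℝ, ℝ) ∞ f →
      MDifferentiableAt 𝓘(ℝ, E) 𝓘(ℝ, ℝ) (derivAlong (fun y => ρ y u) f) x := fun u _ hf =>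
    (hρ.contMDiff_derivAlong u hf).mdifferentiable (by simp) x
  have hs : ∀ i, ContMDiff 𝓘(ℝ, E) 𝓘(ℝ, ℝ) ∞ fun x =>
      (derivAlong (fun y => ρ y (e i : 𝔡)) f x *
          derivAlong (fun y => ρ y (S.toComplement (e.coord i))) g x -
        derivAlong (fun y => ρ y (S.toComplement (e.coord i))) f x *
          derivAlong (fun y => ρ y (e i : 𝔡)) g x) := fun i => by
    refine ContMDiff.sub ?_ ?_ <;>
      exact (hρ.contMDiff_derivAlong _ hf).mul (hρ.contMDiff_derivAlong _ hg)
  -- The right side is read as linear in the Lie algebra element, so that the expansion of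
  -- `twistSharp` in the basis can pass through it.
  change _ = hρ.diffDerivAlong hg x _ - hρ.diffDerivAlong hf x _
  rw [twistBracket_eq_sum, diff_const_mul _
    ((contMDiff_finsetSum fun i _ => hs i).mdifferentiable (by simp) x), diff_sum _ hs,
    S.twistSharp_eq_sum h𝔥 e, S.twistSharp_eq_sum h𝔥 e, map_smul, map_smul, map_sum, map_sum]
  refine Eq.trans ?_ (smul_sub (1 / 2 : ℝ) (_ : Module.Dual ℝ (TangentSpace 𝓘(ℝ, E) x)) _)
  refine congrArg _ (Eq.trans ?_ (Finset.sum_sub_distrib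
    (G := Module.Dual ℝ (TangentSpace 𝓘(ℝ, E) x)) _ _))
  refine Finset.sum_congr rfl fun i _ => ?_
  have hm : ∀ u v : 𝔡, MDifferentiableAt 𝓘(ℝ, E) 𝓘(ℝ, ℝ)
      (fun y => derivAlong (fun y => ρ y u) f y * derivAlong (fun y => ρ y v) g y) x := fun u v =>
    ((hρ.contMDiff_derivAlong u hf).mul (hρ.contMDiff_derivAlong v hg)).mdifferentiable (by simp) x
  rw [diff_sub (hm _ _) (hm _ _), diff_mul (hd _ hf) (hd _ hg),
    diff_mul (hd _ hf) (hd _ hg)]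
  simp only [map_sub, map_smul]
  simp only [IsLieAction.diffDerivAlong, LinearMap.coe_mk, AddHom.coe_mk, moment_apply]
  abel

theorem lieDeriv_twistBracket [CompleteSpace E] (hρ : IsLieAction ρ) (u : 𝔥) {f g : M → ℝ}
    (hf : ContMDiff 𝓘(ℝ, E) 𝓘(ℝ, ℝ) ∞ f) (hg : ContMDiff 𝓘(ℝ, E) 𝓘(ℝ, ℝ) ∞ g) (x : M) :
    lieDeriv (fun y => ρ y (u : 𝔡)) (fun y => push (ρ y) (S.twist e)) f g x =
      S.delta u (restrictForm 𝔥 (moment ρ f x)) (restrictForm 𝔥 (moment ρ g x)) := by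
  rw [← S.delta_eq h𝔥 u]
  change derivAlong _ (twistBracket S e ρ f g) x -
    twistBracket S e ρ (derivAlong (fun y => ρ y (u : 𝔡)) f) g x -
    twistBracket S e ρ f (derivAlong (fun y => ρ y (u : 𝔡)) g) x =
      diff g x (ρ x _) - diff f x (ρ x _)
  rw [hρ.derivAlong_lie _ _ hf, hρ.derivAlong_lie _ _ hg, twistBracket_swap,
    twistBracket_eq_derivAlong S e h𝔥, twistBracket_eq_derivAlong S e h𝔥, derivAlong,
    diff_twistBracket S e h𝔥 hρ hf hg, LinearMap.sub_apply]
  simp only [derivAlong]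
  ring

/-- Each nested bracket is a difference of two second derivatives along fields of the action with
frozen elements. The six resulting terms pair up into three commutators, which `derivAlong_lie`
turns into brackets in `𝔡`. -/
theorem twistBracket_jacobiator [CompleteSpace E] (hρ : IsLieAction ρ) {f g h : M → ℝ}
    (hf : ContMDiff 𝓘(ℝ, E) 𝓘(ℝ, ℝ) ∞ f) (hg : ContMDiff 𝓘(ℝ, E) 𝓘(ℝ, ℝ) ∞ g)
    (hh : ContMDiff 𝓘(ℝ, E) 𝓘(ℝ, ℝ) ∞ h) (x : M) :
    twistBracket S e ρ f (twistBracket S e ρ g h) x +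
      twistBracket S e ρ g (twistBracket S e ρ h f) x +
      twistBracket S e ρ h (twistBracket S e ρ f g) x =
    moment ρ h x ⁅S.twistSharp (moment ρ f x), S.twistSharp (moment ρ g x)⁆ +
      moment ρ f x ⁅S.twistSharp (moment ρ g x), S.twistSharp (moment ρ h x)⁆ +
      moment ρ g x ⁅S.twistSharp (moment ρ h x), S.twistSharp (moment ρ f x)⁆ := by
  have key : ∀ {p q r : M → ℝ}, ContMDiff 𝓘(ℝ, E) 𝓘(ℝ, ℝ) ∞ q → ContMDiff 𝓘(ℝ, E) 𝓘(ℝ, ℝ) ∞ r →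
      twistBracket S e ρ p (twistBracket S e ρ q r) x =
        derivAlong (fun y => ρ y (S.twistSharp (moment ρ p x)))
          (derivAlong (fun y => ρ y (S.twistSharp (moment ρ q x))) r) x -
        derivAlong (fun y => ρ y (S.twistSharp (moment ρ p x)))
          (derivAlong (fun y => ρ y (S.twistSharp (moment ρ r x))) q) x := by
    intro p q r hq hr
    rw [twistBracket_eq_derivAlong S e h𝔥, derivAlong, diff_twistBracket S e h𝔥 hρ hq hr]
    rfl
  rw [key hg hh, key hh hf, key hf hg]
  change _ = diff h x (ρ x _) + diff f x (ρ x _) + diff g x (ρ x _)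
  rw [hρ.derivAlong_lie _ _ hf, hρ.derivAlong_lie _ _ hg, hρ.derivAlong_lie _ _ hh]
  ring

variable {hB : IsInvariantPairing B}

/-- This is the vanishing of `[π, τ]`. With the elements of `𝔡` frozen at `x`, invariance makes them
act as derivations of the bracket of `π`. All terms then cancel by skew-symmetry. -/
theorem twistBracket_mixed_jacobiator (hQ : IsQuasiPoisson hB ρ π) {f g h : M → ℝ}
    (hf : ContMDiff 𝓘(ℝ, E) 𝓘(ℝ, ℝ) ∞ f) (hg : ContMDiff 𝓘(ℝ, E) 𝓘(ℝ, ℝ) ∞ g)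
    (hh : ContMDiff 𝓘(ℝ, E) 𝓘(ℝ, ℝ) ∞ h) (x : M) :
    (bracket π f (twistBracket S e ρ g h) x + bracket π g (twistBracket S e ρ h f) x +
      bracket π h (twistBracket S e ρ f g) x) +
    (twistBracket S e ρ f (bracket π g h) x + twistBracket S e ρ g (bracket π h f) x +
      twistBracket S e ρ h (bracket π f g) x) = 0 := by
  have h1 : ∀ {p q r : M → ℝ}, ContMDiff 𝓘(ℝ, E) 𝓘(ℝ, ℝ) ∞ q → ContMDiff 𝓘(ℝ, E) 𝓘(ℝ, ℝ) ∞ r →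
      bracket π p (twistBracket S e ρ q r) x =
        bracket π p (derivAlong (fun y => ρ y (S.twistSharp (moment ρ q x))) r) x -
        bracket π p (derivAlong (fun y => ρ y (S.twistSharp (moment ρ r x))) q) x := by
    intro p q r hq hr
    rw [bracket, diff_twistBracket S e h𝔥 hQ.action hq hr, map_sub]
    rfl
  have h2 : ∀ {p q r : M → ℝ}, ContMDiff 𝓘(ℝ, E) 𝓘(ℝ, ℝ) ∞ q → ContMDiff 𝓘(ℝ, E) 𝓘(ℝ, ℝ) ∞ r →
      twistBracket S e ρ p (bracket π q r) x =
        bracket π (derivAlong (fun y => ρ y (S.twistSharp (moment ρ p x))) q) r x +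
        bracket π q (derivAlong (fun y => ρ y (S.twistSharp (moment ρ p x))) r) x := by
    intro p q r hq hr
    have := hQ.invariant (S.twistSharp (moment ρ p x)) q r hq hr x
    rw [lieDeriv] at this
    rw [twistBracket_eq_derivAlong S e h𝔥]
    linarith
  rw [h1 hg hh, h1 hh hf, h1 hf hg, h2 hg hh, h2 hh hf, h2 hf hg,
    hQ.bivector.bracket_swap (derivAlong _ g) h, hQ.bivector.bracket_swap (derivAlong _ h) f,
    hQ.bivector.bracket_swap (derivAlong _ f) g]
  ring

theorem schouten_twisted [CompleteSpace E] (hQ : IsQuasiPoisson hB ρ π) {f g h : M → ℝ}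
    (hf : ContMDiff 𝓘(ℝ, E) 𝓘(ℝ, ℝ) ∞ f) (hg : ContMDiff 𝓘(ℝ, E) 𝓘(ℝ, ℝ) ∞ g)
    (hh : ContMDiff 𝓘(ℝ, E) 𝓘(ℝ, ℝ) ∞ h) (x : M) :
    schouten (twisted S e ρ π) (twisted S e ρ π) f g h x / 2 =
      S.phi (restrictForm 𝔥 (moment ρ f x)) (restrictForm 𝔥 (moment ρ g x))
        (restrictForm 𝔥 (moment ρ h x)) := by
  have key : ∀ {p q r : M → ℝ}, ContMDiff 𝓘(ℝ, E) 𝓘(ℝ, ℝ) ∞ q → ContMDiff 𝓘(ℝ, E) 𝓘(ℝ, ℝ) ∞ r →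
      bracket (twisted S e ρ π) p (bracket (twisted S e ρ π) q r) x =
        bracket π p (bracket π q r) x - bracket π p (twistBracket S e ρ q r) x -
        twistBracket S e ρ p (bracket π q r) x +
        twistBracket S e ρ p (twistBracket S e ρ q r) x := by
    intro p q r hq hr
    have h1 := diff_sub ((hQ.bivector.smooth q r hq hr).mdifferentiable (by simp) x)
      ((contMDiff_twistBracket S e hQ.action hq hr).mdifferentiable (by simp) x)
    rw [bracket_twisted S e q r, bracket, h1]
    simp only [twisted, map_sub, LinearMap.sub_apply]
    simp only [bracket, twistBracket]
    ring
  have h1 := hQ.schouten_eq f g h hf hg hh x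
  have h2 := twistBracket_mixed_jacobiator S e h𝔥 hQ hf hg hh x
  have h3 := twistBracket_jacobiator S e h𝔥 hQ.action hf hg hh x
  have h4 := S.phi_eq h𝔥 (moment ρ f x) (moment ρ g x) (moment ρ h x)
  -- `hB` and `S.pairing` prove the same proposition, so the two forms of `φ` agree by proof
  -- irrelevance.
  have h5 : QuasiPoisson.phi hB (moment ρ f x) (moment ρ g x) (moment ρ h x) =
      schouten π π f g h x / 2 := h1.symm
  rw [← h4, ← h3, h5, schouten, schouten, key hg hh, key hh hf, key hf hg]
  linarith

theorem lieDeriv_twisted [CompleteSpace E] (hQ : IsQuasiPoisson hB ρ π) (u : 𝔥) {f g : M → ℝ}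
    (hf : ContMDiff 𝓘(ℝ, E) 𝓘(ℝ, ℝ) ∞ f) (hg : ContMDiff 𝓘(ℝ, E) 𝓘(ℝ, ℝ) ∞ g) (x : M) :
    lieDeriv (fun y => ρ y (u : 𝔡)) (twisted S e ρ π) f g x =
      -S.delta u (restrictForm 𝔥 (moment ρ f x)) (restrictForm 𝔥 (moment ρ g x)) := by
  have h1 := hQ.invariant u f g hf hg x
  have h2 := lieDeriv_twistBracket S e h𝔥 hQ.action u hf hg x
  have h3 : derivAlong (fun y => ρ y (u : 𝔡)) (bracket (twisted S e ρ π) f g) x =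
      derivAlong (fun y => ρ y (u : 𝔡)) (bracket π f g) x -
        derivAlong (fun y => ρ y (u : 𝔡)) (twistBracket S e ρ f g) x := by
    rw [bracket_twisted, derivAlong, diff_sub
      ((hQ.bivector.smooth f g hf hg).mdifferentiable (by simp) x)
      ((contMDiff_twistBracket S e hQ.action hf hg).mdifferentiable (by simp) x)]
    rfl
  change derivAlong _ (twistBracket S e ρ f g) x -
    twistBracket S e ρ (derivAlong (fun y => ρ y (u : 𝔡)) f) g x -
    twistBracket S e ρ f (derivAlong (fun y => ρ y (u : 𝔡)) g) x = _ at h2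
  rw [lieDeriv] at h1 ⊢
  rw [h3, bracket_twisted, bracket_twisted]
  linarith

omit h𝔥 in
theorem contMDiff_bracket_twisted (hQ : IsQuasiPoisson hB ρ π) {f g : M → ℝ}
    (hf : ContMDiff 𝓘(ℝ, E) 𝓘(ℝ, ℝ) ∞ f) (hg : ContMDiff 𝓘(ℝ, E) 𝓘(ℝ, ℝ) ∞ g) :
    ContMDiff 𝓘(ℝ, E) 𝓘(ℝ, ℝ) ∞ (bracket (twisted S e ρ π) f g) :=
  (hQ.bivector.smooth f g hf hg).sub (contMDiff_twistBracket S e hQ.action hf hg)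

end TwistedBracket

/-! ### Local retractions onto immersed manifolds and extension of functions. -/

section Immersion

variable {E : Type*} [NormedAddCommGroup E] [NormedSpace ℝ E]
  {M : Type*} [TopologicalSpace M] [ChartedSpace E M]
  {E' : Type*} [NormedAddCommGroup E'] [NormedSpace ℝ E']
  {X : Type*} [TopologicalSpace X] [ChartedSpace E' X]
  {ι : X → M}

/-- In the charts of the immersion `ι` is `v ↦ (v, 0)`, so projecting to the first factor retracts.
The identity `r ∘ ι = id` is claimed only near `x` in the topology of `X`, since other parts of an
immersed leaf may return to `U`. -/
theorem exists_local_retraction (hι : Manifold.IsImmersion 𝓘(ℝ, E') 𝓘(ℝ, E) ∞ ι) (x : X) :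
    ∃ U : Set M, IsOpen U ∧ ι x ∈ U ∧ ∃ r : M → X, ContMDiffOn 𝓘(ℝ, E) 𝓘(ℝ, E') ∞ r U ∧
      ∀ᶠ y in nhds x, r (ι y) = y := by
  have h := hι.isImmersionAt x
  let g : M → E' := fun p => (h.equiv.symm (h.codChart p)).1
  have hg : ContMDiffOn 𝓘(ℝ, E) 𝓘(ℝ, E') ∞ g h.codChart.source := by
    have h1 : ContDiff ℝ ∞ (fun v : E => (h.equiv.symm v).1) :=
      contDiff_fst.comp h.equiv.symm.contDiff
    exact h1.contMDiff.comp_contMDiffOn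
      (contMDiffOn_of_mem_maximalAtlas h.codChart_mem_maximalAtlas)
  have hleft : ∀ y ∈ h.domChart.source, g (ι y) = h.domChart y := by
    intro y hy
    have h1 : h.codChart (ι (h.domChart.symm (h.domChart y))) = h.equiv (h.domChart y, 0) :=
      h.writtenInCharts (by simpa using h.domChart.map_source hy)
    rw [h.domChart.left_inv hy] at h1
    simp [g, h1]
  -- The neighbourhood is shrunk so that the projection lands where the inverse chart of `X` is
  -- smooth.
  refine ⟨h.codChart.source ∩ g ⁻¹' h.domChart.target,
    hg.continuousOn.isOpen_inter_preimage h.codChart.open_source h.domChart.open_target,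
    ⟨h.mem_codChart_source, ?_⟩, h.domChart.symm ∘ g, ?_, ?_⟩
  · rw [Set.mem_preimage, hleft x h.mem_domChart_source]
    exact h.domChart.map_source h.mem_domChart_source
  · exact (contMDiffOn_symm_of_mem_maximalAtlas h.domChart_mem_maximalAtlas).comp
      (hg.mono Set.inter_subset_left) fun p hp => hp.2
  · filter_upwards [h.domChart.open_source.mem_nhds h.mem_domChart_source] with y hy
    rw [Function.comp_apply, hleft y hy, h.domChart.left_inv hy]

theorem mfderiv_injective_of_isImmersion [IsManifold 𝓘(ℝ, E) ∞ M] [IsManifold 𝓘(ℝ, E') ∞ X]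
    (hι : Manifold.IsImmersion 𝓘(ℝ, E') 𝓘(ℝ, E) ∞ ι) (x : X) :
    Function.Injective (mfderiv 𝓘(ℝ, E') 𝓘(ℝ, E) ι x) := by
  obtain ⟨U, hU, hx, r, hr, hrx⟩ := exists_local_retraction hι x
  have h1 : MDifferentiableAt 𝓘(ℝ, E) 𝓘(ℝ, E') r (ι x) :=
    ((hr _ hx).contMDiffAt (hU.mem_nhds hx)).mdifferentiableAt (by simp)
  have h2 : MDifferentiableAt 𝓘(ℝ, E') 𝓘(ℝ, E) ι x := hι.contMDiff.mdifferentiable (by simp) x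
  have h3 := mfderiv_comp x h1 h2
  have h4 : r ∘ ι =ᶠ[nhds x] id := hrx
  rw [h4.mfderiv_eq, mfderiv_id] at h3
  intro v w hvw
  have hv := congrArg (fun L : E' →L[ℝ] E' => L v) h3
  have hw := congrArg (fun L : E' →L[ℝ] E' => L w) h3
  refine (hv.trans ?_).trans hw.symm
  exact congrArg (mfderiv 𝓘(ℝ, E) 𝓘(ℝ, E') r (ι x)) hvw

theorem exists_contMDiff_comp_eventuallyEq [FiniteDimensional ℝ E] [T2Space M]
    [IsManifold 𝓘(ℝ, E) ∞ M]
    (hι : Manifold.IsImmersion 𝓘(ℝ, E') 𝓘(ℝ, E) ∞ ι) (x : X) {f : X → ℝ}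
    (hf : ContMDiff 𝓘(ℝ, E') 𝓘(ℝ, ℝ) ∞ f) :
    ∃ F : M → ℝ, ContMDiff 𝓘(ℝ, E) 𝓘(ℝ, ℝ) ∞ F ∧ F ∘ ι =ᶠ[nhds x] f := by
  obtain ⟨U, hU, hx, r, hr, hrx⟩ := exists_local_retraction hι x
  obtain ⟨F, hF, hFe⟩ := exists_contMDiff_eventuallyEq hU hx (hf.comp_contMDiffOn hr)
  refine ⟨F, hF, ?_⟩
  filter_upwards [(hι.isImmersionAt x).continuousAt.eventually hFe, hrx] with y h1 h2
  simp only [Function.comp_apply] at h1 ⊢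
  rw [h1, h2]

end Immersion

/-! ### Bivectors supported on a subspace. -/

section Tensors

variable {V W : Type*} [AddCommGroup V] [Module ℝ V] [AddCommGroup W] [Module ℝ W]

/-- A form that vanishes on `L(V)` annihilates every vector `s(·, β)`, hence drops out of the first
slot of `s`, and out of the second by alternation. So `s` descends along `L.dualMap`, and any right
inverse `R` of that map computes the descended tensor. -/
theorem exists_push_eq_of_imageRight_le [FiniteDimensional ℝ W] {L : V →ₗ[ℝ] W}
    (hL : Function.Injective L) {s : Tensor2 W} (hs : s.IsAlt)
    (h : imageRight s ≤ LinearMap.range L) :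
    ∃ t : Tensor2 V, t.IsAlt ∧ push L t = s := by
  have h0 : ∀ γ β : Module.Dual ℝ W, L.dualMap γ = 0 → s γ β = 0 := by
    intro γ β hγ
    obtain ⟨w, hw⟩ := (Module.evalEquiv ℝ W).surjective (s.flip β)
    have hw' : Module.Dual.eval ℝ W w = s.flip β := hw
    obtain ⟨v, rfl⟩ := h (show w ∈ imageRight s from ⟨β, hw'.symm⟩)
    have h1 : γ (L v) = s γ β := congrArg (fun l : Module.Dual ℝ (Module.Dual ℝ W) => l γ) hw'
    rw [← h1]
    exact LinearMap.congr_fun hγ v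
  obtain ⟨R, hR⟩ := L.dualMap.exists_rightInverse_of_surjective
    (LinearMap.range_eq_top.2 (LinearMap.dualMap_surjective_of_injective hL))
  have hR' : ∀ α, L.dualMap (R α) = α := LinearMap.congr_fun hR
  refine ⟨s.compl₁₂ R R, fun α => hs _, ?_⟩
  have h1 : ∀ α β, s (R (L.dualMap α)) β = s α β := fun α β => by
    rw [← sub_eq_zero, ← LinearMap.sub_apply, ← map_sub]
    exact h0 _ _ (by rw [map_sub, hR', sub_self])
  refine LinearMap.ext₂ fun α β => ?_
  change s (R (L.dualMap α)) (R (L.dualMap β)) = s α β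
  rw [h1, ← hs.neg_eq, h1, hs.neg_eq]

theorem push_apply (L : V →ₗ[ℝ] W) (s : Tensor2 V) (α β : Module.Dual ℝ W) :
    push L s α β = s (L.dualMap α) (L.dualMap β) := rfl

end Tensors

/-! ### Transfer of derivatives and brackets along an immersion. -/

section Restriction

variable {E : Type*} [NormedAddCommGroup E] [NormedSpace ℝ E]
  {M : Type*} [TopologicalSpace M] [ChartedSpace E M]
  {E' : Type*} [NormedAddCommGroup E'] [NormedSpace ℝ E']
  {X : Type*} [TopologicalSpace X] [ChartedSpace E' X]
  {ι : X → M}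

theorem diff_eq_dualMap_diff (hι : ContMDiff 𝓘(ℝ, E') 𝓘(ℝ, E) ∞ ι) {x : X} {F : M → ℝ}
    (hF : ContMDiff 𝓘(ℝ, E) 𝓘(ℝ, ℝ) ∞ F) {f : X → ℝ} (hFf : F ∘ ι =ᶠ[nhds x] f) :
    diff f x = (mfderiv 𝓘(ℝ, E') 𝓘(ℝ, E) ι x).toLinearMap.dualMap (diff (E := E) F (ι x)) := by
  rw [← diff_congr hFf, diff_comp (E' := E) (hF.mdifferentiable (by simp) _)
    (hι.mdifferentiable (by simp) _)]

theorem derivAlong_comp_eventuallyEq (hι : ContMDiff 𝓘(ℝ, E') 𝓘(ℝ, E) ∞ ι)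
    {V : ∀ x : M, TangentSpace 𝓘(ℝ, E) x} {V' : ∀ x : X, TangentSpace 𝓘(ℝ, E') x}
    (hV : ∀ x, mfderiv 𝓘(ℝ, E') 𝓘(ℝ, E) ι x (V' x) = V (ι x)) {x : X} {F : M → ℝ}
    (hF : ContMDiff 𝓘(ℝ, E) 𝓘(ℝ, ℝ) ∞ F) {f : X → ℝ} (hFf : F ∘ ι =ᶠ[nhds x] f) :
    derivAlong V F ∘ ι =ᶠ[nhds x] derivAlong V' f := by
  filter_upwards [hFf.eventuallyEq_nhds] with y hy
  rw [derivAlong, diff_eq_dualMap_diff hι hF hy, Function.comp_apply, derivAlong, ← hV]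
  rfl

/-- Agreement near `x`, and not only at `x`, is what allows the result to be fed into a further
bracket or derivative. -/
theorem bracket_comp_eventuallyEq (hι : ContMDiff 𝓘(ℝ, E') 𝓘(ℝ, E) ∞ ι)
    {s : ∀ x : M, Tensor2 (TangentSpace 𝓘(ℝ, E) x)}
    {s' : ∀ x : X, Tensor2 (TangentSpace 𝓘(ℝ, E') x)}
    (hs : ∀ x, push (mfderiv 𝓘(ℝ, E') 𝓘(ℝ, E) ι x).toLinearMap (s' x) = s (ι x))
    {x : X} {F G : M → ℝ}
    (hF : ContMDiff 𝓘(ℝ, E) 𝓘(ℝ, ℝ) ∞ F) (hG : ContMDiff 𝓘(ℝ, E) 𝓘(ℝ, ℝ) ∞ G)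
    {f g : X → ℝ} (hFf : F ∘ ι =ᶠ[nhds x] f) (hGg : G ∘ ι =ᶠ[nhds x] g) :
    bracket s F G ∘ ι =ᶠ[nhds x] bracket s' f g := by
  filter_upwards [hFf.eventuallyEq_nhds, hGg.eventuallyEq_nhds] with y hf hg
  rw [bracket, diff_eq_dualMap_diff hι hF hf, diff_eq_dualMap_diff hι hG hg,
    Function.comp_apply, bracket, ← hs]
  rfl

theorem contMDiff_of_forall_eventuallyEq_comp (hι : ContMDiff 𝓘(ℝ, E') 𝓘(ℝ, E) ∞ ι) {f : X → ℝ}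
    (h : ∀ x, ∃ F : M → ℝ, ContMDiff 𝓘(ℝ, E) 𝓘(ℝ, ℝ) ∞ F ∧ F ∘ ι =ᶠ[nhds x] f) :
    ContMDiff 𝓘(ℝ, E') 𝓘(ℝ, ℝ) ∞ f := fun x => by
  obtain ⟨F, hF, hFf⟩ := h x
  exact (hF.comp hι).contMDiffAt.congr_of_eventuallyEq hFf.symm

variable [FiniteDimensional ℝ E] [T2Space M] [IsManifold 𝓘(ℝ, E) ∞ M]
  [FiniteDimensional ℝ E'] [IsManifold 𝓘(ℝ, E') ∞ X]
  {𝔡 : Type*} [LieRing 𝔡] [LieAlgebra ℝ 𝔡]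

/-- Smoothness and compatibility with brackets are both tested on functions of `X`. Each is extended
locally to `M`, where the action axioms are known. -/
theorem isLieAction_of_related [T2Space X] (hι : Manifold.IsImmersion 𝓘(ℝ, E') 𝓘(ℝ, E) ∞ ι)
    {ρ : ∀ x : M, 𝔡 →ₗ[ℝ] TangentSpace 𝓘(ℝ, E) x} (hρ : IsLieAction ρ) {𝔥 : LieSubalgebra ℝ 𝔡}
    {ρX : ∀ x : X, 𝔥 →ₗ[ℝ] TangentSpace 𝓘(ℝ, E') x}
    (hρX : ∀ (x : X) (u : 𝔥), mfderiv 𝓘(ℝ, E') 𝓘(ℝ, E) ι x (ρX x u) = ρ (ι x) (u : 𝔡)) :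
    IsLieAction ρX := by
  have hd : ∀ (u : 𝔥) {x : X} {F : M → ℝ} {f : X → ℝ}, ContMDiff 𝓘(ℝ, E) 𝓘(ℝ, ℝ) ∞ F →
      F ∘ ι =ᶠ[nhds x] f → derivAlong (fun y => ρ y (u : 𝔡)) F ∘ ι =ᶠ[nhds x]
        derivAlong (fun y => ρX y u) f := fun u _ _ _ hF hFf =>
    derivAlong_comp_eventuallyEq hι.contMDiff (fun x => hρX x u) hF hFf
  have hsm : ∀ u : 𝔥, ContMDiff 𝓘(ℝ, E') 𝓘(ℝ, E').tangent ∞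
      (fun x => (⟨x, ρX x u⟩ : TangentBundle 𝓘(ℝ, E') X)) := fun u => by
    refine contMDiff_of_forall_derivAlong fun f hf =>
      contMDiff_of_forall_eventuallyEq_comp hι.contMDiff fun x => ?_
    obtain ⟨F, hF, hFf⟩ := exists_contMDiff_comp_eventuallyEq hι x hf
    exact ⟨_, hρ.contMDiff_derivAlong u hF, hd u hF hFf⟩
  refine ⟨hsm, fun u v x => eq_of_forall_diff_eq fun f hf => ?_⟩
  obtain ⟨F, hF, hFf⟩ := exists_contMDiff_comp_eventuallyEq hι x hf
  rw [diff_mlieBracket (hsm u) (hsm v) hf,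
    ← (hd u (hρ.contMDiff_derivAlong v hF) (hd v hF hFf)).eq_of_nhds,
    ← (hd v (hρ.contMDiff_derivAlong u hF) (hd u hF hFf)).eq_of_nhds]
  refine Eq.trans ?_ (hρ.derivAlong_lie (u : 𝔡) v hF (ι x))
  exact (hd ⁅u, v⁆ hF hFf).eq_of_nhds.symm

end Restriction

/-! ### The quasi-Poisson structure induced on a leaf. -/

section Leaf

variable {E : Type*} [NormedAddCommGroup E] [NormedSpace ℝ E] [FiniteDimensional ℝ E]
  {M : Type u} [TopologicalSpace M] [T2Space M] [ChartedSpace E M] [IsManifold 𝓘(ℝ, E) ∞ M]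
  {𝔡 : Type*} [LieRing 𝔡] [LieAlgebra ℝ 𝔡] [FiniteDimensional ℝ 𝔡]
  {B : LinearMap.BilinForm ℝ 𝔡} {hB : IsInvariantPairing B}
  {ρ : ∀ x : M, 𝔡 →ₗ[ℝ] TangentSpace 𝓘(ℝ, E) x}
  {π : ∀ x : M, Tensor2 (TangentSpace 𝓘(ℝ, E) x)}
  {n : ℕ} {X : Type u} [TopologicalSpace X] [ChartedSpace (EuclideanSpace ℝ (Fin n)) X]
  [IsManifold 𝓘(ℝ, EuclideanSpace ℝ (Fin n)) ∞ X] {ι : X → M}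
  {𝔥 : LieSubalgebra ℝ 𝔡} {k : Submodule ℝ 𝔡} {κ : Type*} [Fintype κ]

theorem isManinQuasiPoisson_of_restriction [T2Space X]
    (hι : Manifold.IsImmersion 𝓘(ℝ, EuclideanSpace ℝ (Fin n)) 𝓘(ℝ, E) ∞ ι)
    (hQ : IsQuasiPoisson hB ρ π) (S : IsComplemented B 𝔥 k) (e : Module.Basis κ ℝ 𝔥)
    (h𝔥 : IsLagrangian B 𝔥.toSubmodule)
    {ρX : ∀ x : X, 𝔥 →ₗ[ℝ] TangentSpace 𝓘(ℝ, EuclideanSpace ℝ (Fin n)) x}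
    {πX : ∀ x : X, Tensor2 (TangentSpace 𝓘(ℝ, EuclideanSpace ℝ (Fin n)) x)}
    (hρX : IsActionRestriction n ι ρ ρX)
    (hπX : IsBivectorRestriction n ι (twisted S e ρ π) πX)
    (halt : ∀ x, (πX x).IsAlt) : IsManinQuasiPoisson S ρX πX := by
  have hb : ∀ {x : X} {F G : M → ℝ} {f g : X → ℝ}, ContMDiff 𝓘(ℝ, E) 𝓘(ℝ, ℝ) ∞ F →
      ContMDiff 𝓘(ℝ, E) 𝓘(ℝ, ℝ) ∞ G → F ∘ ι =ᶠ[nhds x] f → G ∘ ι =ᶠ[nhds x] g →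
      bracket (twisted S e ρ π) F G ∘ ι =ᶠ[nhds x] bracket πX f g :=
    fun hF hG hFf hGg => bracket_comp_eventuallyEq hι.contMDiff hπX hF hG hFf hGg
  have hd : ∀ (u : 𝔥) {x : X} {F : M → ℝ} {f : X → ℝ}, ContMDiff 𝓘(ℝ, E) 𝓘(ℝ, ℝ) ∞ F →
      F ∘ ι =ᶠ[nhds x] f → derivAlong (fun y => ρ y (u : 𝔡)) F ∘ ι =ᶠ[nhds x]
        derivAlong (fun y => ρX y u) f := fun u _ _ _ hF hFf =>
    derivAlong_comp_eventuallyEq hι.contMDiff (fun x => hρX x u) hF hFf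
  -- Pulling `df` back by the action on `X` gives the restriction to `𝔥` of the moment of an
  -- extension. Thus the right sides proved on `M` become those required on `X`.
  have hm : ∀ {x : X} {F : M → ℝ} {f : X → ℝ}, ContMDiff 𝓘(ℝ, E) 𝓘(ℝ, ℝ) ∞ F →
      F ∘ ι =ᶠ[nhds x] f →
      (ρX x).dualMap (diff f x) = restrictForm 𝔥 (moment ρ F (ι x)) := fun hF hFf =>
    LinearMap.ext fun u => (hd u hF hFf).eq_of_nhds.symm
  have hsb := fun {F G : M → ℝ} hF hG =>
    contMDiff_bracket_twisted S e hQ (f := F) (g := G) hF hG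
  refine ⟨h𝔥, isLieAction_of_related hι hQ.action hρX, ⟨halt, fun f g hf hg => ?_⟩,
    fun f g h hf hg hh x => ?_, fun u f g hf hg x => ?_⟩
  · refine contMDiff_of_forall_eventuallyEq_comp hι.contMDiff fun x => ?_
    obtain ⟨F, hF, hFf⟩ := exists_contMDiff_comp_eventuallyEq hι x hf
    obtain ⟨G, hG, hGg⟩ := exists_contMDiff_comp_eventuallyEq hι x hg
    exact ⟨_, hsb hF hG, hb hF hG hFf hGg⟩
  · obtain ⟨F, hF, hFf⟩ := exists_contMDiff_comp_eventuallyEq hι x hf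
    obtain ⟨G, hG, hGg⟩ := exists_contMDiff_comp_eventuallyEq hι x hg
    obtain ⟨H, hH, hHh⟩ := exists_contMDiff_comp_eventuallyEq hι x hh
    rw [hm hF hFf, hm hG hGg, hm hH hHh, ← schouten_twisted S e h𝔥 hQ hF hG hH, schouten, schouten,
      ← (hb hF (hsb hG hH) hFf (hb hG hH hGg hHh)).eq_of_nhds,
      ← (hb hG (hsb hH hF) hGg (hb hH hF hHh hFf)).eq_of_nhds,
      ← (hb hH (hsb hF hG) hHh (hb hF hG hFf hGg)).eq_of_nhds]
    rfl
  · obtain ⟨F, hF, hFf⟩ := exists_contMDiff_comp_eventuallyEq hι x hf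
    obtain ⟨G, hG, hGg⟩ := exists_contMDiff_comp_eventuallyEq hι x hg
    rw [hm hF hFf, hm hG hGg, ← lieDeriv_twisted S e h𝔥 hQ u hF hG, lieDeriv, lieDeriv,
      ← (hd u (hsb hF hG) (hb hF hG hFf hGg)).eq_of_nhds,
      ← (hb (hQ.action.contMDiff_derivAlong u hF) hG (hd u hF hFf) hGg).eq_of_nhds,
      ← (hb hF (hQ.action.contMDiff_derivAlong u hG) hFf (hd u hG hGg)).eq_of_nhds]
    rfl

end Leaf

/-! ### Comparison of `σ` with the twisted bivector field. -/

section Tangency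

variable {E : Type*} [NormedAddCommGroup E] [NormedSpace ℝ E]
  {M : Type u} [TopologicalSpace M] [ChartedSpace E M]
  {𝔡 : Type*} [LieRing 𝔡] [LieAlgebra ℝ 𝔡] [FiniteDimensional ℝ 𝔡]
  {B : LinearMap.BilinForm ℝ 𝔡} {hB : IsInvariantPairing B}
  {ρ : ∀ x : M, 𝔡 →ₗ[ℝ] TangentSpace 𝓘(ℝ, E) x}
  {π : ∀ x : M, Tensor2 (TangentSpace 𝓘(ℝ, E) x)}
  {𝔥 : LieSubalgebra ℝ 𝔡} {k : Submodule ℝ 𝔡} {κ : Type*} [Fintype κ]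

/-- With `t^♯ ρ*α = p + q`, the tensor `½t` contributes `(p + q) / 2` to `σ(·, α)`, while `-τ`
contributes `(q - p) / 2` to `π'(·, α)`. The difference is `p ∈ 𝔥`, which is the witness. -/
theorem exists_sigma_apply_eq (S : IsComplemented B 𝔥 k) (h𝔥 : IsLagrangian B 𝔥.toSubmodule)
    (e : Module.Basis κ ℝ 𝔥) (x : M) (α : Module.Dual ℝ (TangentSpace 𝓘(ℝ, E) x)) :
    ∃ u : 𝔥, ∀ γ : Module.Dual ℝ (TangentSpace 𝓘(ℝ, E) x),
      sigma hB ρ π x γ α = twisted S e ρ π x γ α + γ (ρ x (u : 𝔡)) := by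
  refine ⟨⟨_, S.sharp_sub_toComplement_mem h𝔥 ((ρ x).dualMap α)⟩, fun γ => ?_⟩
  have h1 : push (ρ x) (S.twist e) γ α =
      -((ρ x).dualMap γ) (S.twistSharp ((ρ x).dualMap α)) := by
    rw [push_apply, S.twist_swap, S.twist_eq_apply_twistSharp h𝔥 e]
  have h2 : push (ρ x) (tTensor hB) γ α = ((ρ x).dualMap γ) (sharp hB ((ρ x).dualMap α)) := by
    change (ρ x).dualMap α (sharp hB ((ρ x).dualMap γ)) = _
    rw [← pairing_sharp hB, ← pairing_sharp hB ((ρ x).dualMap γ), hB.pairing_comm]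
  have h3 : γ (ρ x (sharp S.pairing ((ρ x).dualMap α) -
      S.toComplement (restrictForm 𝔥 ((ρ x).dualMap α)))) =
      (ρ x).dualMap γ (sharp S.pairing ((ρ x).dualMap α) -
      S.toComplement (restrictForm 𝔥 ((ρ x).dualMap α))) := rfl
  rw [h3]
  simp only [sigma, twisted, LinearMap.add_apply, LinearMap.sub_apply, LinearMap.smul_apply, h1, h2]
  simp only [IsComplemented.twistSharp, LinearMap.sub_apply, LinearMap.comp_apply,
    LinearMap.smul_apply, map_sub, map_smul, smul_eq_mul]
  ring

theorem twisted_isAlt (S : IsComplemented B 𝔥 k) (e : Module.Basis κ ℝ 𝔥) {x : M}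
    (hπ : (π x).IsAlt) : (twisted S e ρ π x).IsAlt := fun α => by
  have h := S.twist_swap e ((ρ x).dualMap α) ((ρ x).dualMap α)
  rw [twisted, LinearMap.sub_apply, LinearMap.sub_apply, hπ, push_apply, self_eq_neg.1 h, sub_zero]

theorem imageRight_twisted_le (S : IsComplemented B 𝔥 k) (h𝔥 : IsLagrangian B 𝔥.toSubmodule)
    (e : Module.Basis κ ℝ 𝔥) {x : M} {T : Submodule ℝ (TangentSpace 𝓘(ℝ, E) x)}
    (hT : leftDistribution hB ρ π x ≤ T) (hρ : ∀ u : 𝔥, ρ x (u : 𝔡) ∈ T) :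
    imageRight (twisted S e ρ π x) ≤ T := by
  rintro w ⟨α, hα⟩
  obtain ⟨u, hu⟩ := exists_sigma_apply_eq (hB := hB) (ρ := ρ) (π := π) S h𝔥 e x α
  have h1 : w + ρ x (u : 𝔡) ∈ leftDistribution hB ρ π x := by
    refine ⟨α, LinearMap.ext fun γ => ?_⟩
    have h2 : twisted S e ρ π x γ α = γ w :=
      congrArg (fun l : Module.Dual ℝ (Module.Dual ℝ (TangentSpace 𝓘(ℝ, E) x)) => l γ) hα
    change sigma hB ρ π x γ α = γ (w + ρ x (u : 𝔡))
    rw [hu, h2, map_add]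
  exact (T.add_mem_iff_left (hρ u)).1 (hT h1)

variable {n : ℕ} {X : Type u} [TopologicalSpace X] [ChartedSpace (EuclideanSpace ℝ (Fin n)) X]
  {ι : X → M}

theorem bigDistribution_restriction_eq_top (S : IsComplemented B 𝔥 k)
    (h𝔥 : IsLagrangian B 𝔥.toSubmodule) (e : Module.Basis κ ℝ 𝔥)
    {ρX : ∀ x : X, 𝔥 →ₗ[ℝ] TangentSpace 𝓘(ℝ, EuclideanSpace ℝ (Fin n)) x}
    {πX : ∀ x : X, Tensor2 (TangentSpace 𝓘(ℝ, EuclideanSpace ℝ (Fin n)) x)}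
    (hρX : IsActionRestriction n ι ρ ρX)
    (hπX : IsBivectorRestriction n ι (twisted S e ρ π) πX) {x : X} (halt : (πX x).IsAlt)
    (hι : Function.Injective (mfderiv 𝓘(ℝ, EuclideanSpace ℝ (Fin n)) 𝓘(ℝ, E) ι x))
    (hT : LinearMap.range (mfderiv 𝓘(ℝ, EuclideanSpace ℝ (Fin n)) 𝓘(ℝ, E) ι x).toLinearMap ≤
      leftDistribution hB ρ π (ι x)) :
    bigDistribution ρX πX x = ⊤ := by
  set L := (mfderiv 𝓘(ℝ, EuclideanSpace ℝ (Fin n)) 𝓘(ℝ, E) ι x).toLinearMap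
  refine eq_top_iff.2 fun v _ => ?_
  obtain ⟨α, hα⟩ := hT ⟨v, rfl⟩
  obtain ⟨u, hu⟩ := exists_sigma_apply_eq (hB := hB) (ρ := ρ) (π := π) S h𝔥 e (ι x) α
  have h1 : v - ρX x u ∈ imageLeft (πX x) := by
    -- The sign is needed because `imageLeft` fills the first slot, whereas `σ(·, α)` has `α` in the
    -- second.
    refine ⟨-L.dualMap α, LinearMap.ext fun δ => ?_⟩
    obtain ⟨γ, rfl⟩ := LinearMap.dualMap_surjective_of_injective (f := L) hι δ
    have h2 : sigma hB ρ π (ι x) γ α = γ (L v) :=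
      congrArg (fun l : Module.Dual ℝ (Module.Dual ℝ (TangentSpace 𝓘(ℝ, E) (ι x))) => l γ) hα
    have h3 : πX x (L.dualMap γ) (L.dualMap α) = twisted S e ρ π (ι x) γ α :=
      LinearMap.congr_fun₂ (hπX x) γ α
    have h4 : L (ρX x u) = ρ (ι x) (u : 𝔡) := hρX x u
    change πX x (-L.dualMap α) (L.dualMap γ) = γ (L (v - ρX x u))
    rw [map_neg, LinearMap.neg_apply, halt.neg_eq, h3, map_sub, map_sub, ← h2, hu, h4,
      add_sub_cancel_right]
  rw [← add_sub_cancel (ρX x u) v]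
  exact Submodule.add_mem_sup ⟨u, rfl⟩ h1

end Tangency

theorem exists_isActionRestriction {E : Type*} [NormedAddCommGroup E] [NormedSpace ℝ E]
    {M : Type u} [TopologicalSpace M] [ChartedSpace E M]
    {𝔡 : Type*} [LieRing 𝔡] [LieAlgebra ℝ 𝔡] (ρ : ∀ x : M, 𝔡 →ₗ[ℝ] TangentSpace 𝓘(ℝ, E) x)
    {n : ℕ} {X : Type u} [TopologicalSpace X] [ChartedSpace (EuclideanSpace ℝ (Fin n)) X]
    {ι : X → M} {𝔥 : LieSubalgebra ℝ 𝔡}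
    (h : ∀ (x : X) (u : 𝔥), ρ (ι x) (u : 𝔡) ∈
      LinearMap.range (mfderiv 𝓘(ℝ, EuclideanSpace ℝ (Fin n)) 𝓘(ℝ, E) ι x).toLinearMap)
    (hι : ∀ x, Function.Injective (mfderiv 𝓘(ℝ, EuclideanSpace ℝ (Fin n)) 𝓘(ℝ, E) ι x)) :
    ∃ ρX : ∀ x : X, 𝔥 →ₗ[ℝ] TangentSpace 𝓘(ℝ, EuclideanSpace ℝ (Fin n)) x,
      IsActionRestriction n ι ρ ρX := by
  let L := fun x => (mfderiv 𝓘(ℝ, EuclideanSpace ℝ (Fin n)) 𝓘(ℝ, E) ι x).toLinearMap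
  refine ⟨fun x => (LinearEquiv.ofInjective (L x) (hι x)).symm.toLinearMap ∘ₗ
    LinearMap.codRestrict (LinearMap.range (L x)) (ρ (ι x) ∘ₗ 𝔥.toSubmodule.subtype) (h x),
    fun x u => ?_⟩
  exact congrArg Subtype.val ((LinearEquiv.ofInjective (L x) (hι x)).apply_symm_apply
    ⟨ρ (ι x) (u : 𝔡), h x u⟩)

/-- Maximality is automatic, since the range of `id` is already the whole of `X`. -/
theorem isLeaf_id_of_eq_top {n : ℕ} {X : Type u} [TopologicalSpace X]
    [ChartedSpace (EuclideanSpace ℝ (Fin n)) X]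
    [IsManifold 𝓘(ℝ, EuclideanSpace ℝ (Fin n)) ∞ X] [hX : ConnectedSpace X]
    {D : ∀ x : X, Submodule ℝ (TangentSpace 𝓘(ℝ, EuclideanSpace ℝ (Fin n)) x)}
    (hD : ∀ x, D x = ⊤) : IsLeaf D n (id : X → X) where
  connected := hX
  immersion := Manifold.IsImmersion.id
  injective := Function.injective_id
  tangent x := by
    refine Eq.trans ?_ (hD x).symm
    rw [mfderiv_id]
    exact LinearMap.range_id
  maximal _ _ _ _ _ _ _ _ := fun x _ => ⟨x, rfl⟩

end QuasiPoisson

end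

open QuasiPoisson in
theorem mainTheorem7
    {E : Type*} [NormedAddCommGroup E] [NormedSpace ℝ E] [FiniteDimensional ℝ E]
    {M : Type u} [TopologicalSpace M] [T2Space M] [ChartedSpace E M] [IsManifold 𝓘(ℝ, E) ∞ M]
    {𝔡 : Type*} [LieRing 𝔡] [LieAlgebra ℝ 𝔡] [FiniteDimensional ℝ 𝔡]
    {B : LinearMap.BilinForm ℝ 𝔡} (hB : IsInvariantPairing B)
    (ρ : ∀ x : M, 𝔡 →ₗ[ℝ] TangentSpace 𝓘(ℝ, E) x)
    (π : ∀ x : M, Tensor2 (TangentSpace 𝓘(ℝ, E) x))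
    (hM : IsSplitSymplectic hB ρ π)
    {n : ℕ} {X : Type u} [TopologicalSpace X] [ChartedSpace (EuclideanSpace ℝ (Fin n)) X]
    [IsManifold 𝓘(ℝ, EuclideanSpace ℝ (Fin n)) ∞ X]
    (ι : X → M) (hX : IsLeaf (leftDistribution hB ρ π) n ι)
    (𝔥 : LieSubalgebra ℝ 𝔡) (h𝔥 : 𝔥.toSubmodule = stabilizer ρ n ι)
    (k : Submodule ℝ 𝔡) (hk : IsLagrangian B k) (hc : IsCompl 𝔥.toSubmodule k)
    {κ : Type*} [Fintype κ] (e : Module.Basis κ ℝ 𝔥) :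
    IsTangent n ι (twisted ⟨hB, hk, hc⟩ e ρ π) ∧
      ∃ (ρX : ∀ x : X, 𝔥 →ₗ[ℝ] TangentSpace 𝓘(ℝ, EuclideanSpace ℝ (Fin n)) x)
        (πX : ∀ x : X, Tensor2 (TangentSpace 𝓘(ℝ, EuclideanSpace ℝ (Fin n)) x)),
        IsActionRestriction n ι ρ ρX ∧
        IsBivectorRestriction n ι (twisted ⟨hB, hk, hc⟩ e ρ π) πX ∧
        IsQuasiSymplectic n ⟨hB, hk, hc⟩ ρX πX := by
  have h𝔥L : IsLagrangian B 𝔥.toSubmodule := h𝔥 ▸ hM.lagrangian n X ι hX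
  have hι := hX.immersion
  have hinj := mfderiv_injective_of_isImmersion hι
  -- Hausdorffness, inherited from `M`, provides the bump functions on `X` used to test vector
  -- fields there.
  have : T2Space X := T2Space.of_injective_continuous hX.injective hι.contMDiff.continuous
  have := hX.connected
  have hmem : ∀ (x : X) (u : 𝔥), ρ (ι x) (u : 𝔡) ∈
      LinearMap.range (mfderiv 𝓘(ℝ, EuclideanSpace ℝ (Fin n)) 𝓘(ℝ, E) ι x).toLinearMap := by
    intro x u
    have hu : (u : 𝔡) ∈ stabilizer ρ n ι := h𝔥 ▸ u.2
    exact Submodule.mem_iInf _ |>.1 hu x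
  have htan : IsTangent n ι (twisted ⟨hB, hk, hc⟩ e ρ π) := fun x => by
    have : FiniteDimensional ℝ (TangentSpace 𝓘(ℝ, E) (ι x)) := inferInstanceAs
      (FiniteDimensional ℝ E)
    exact exists_push_eq_of_imageRight_le (hinj x) (twisted_isAlt _ e (hM.bivector.alt _))
      (imageRight_twisted_le _ h𝔥L e (hX.tangent x).ge (hmem x))
  obtain ⟨ρX, hρX⟩ := exists_isActionRestriction ρ hmem hinj
  choose πX halt hπX using id htan
  exact ⟨htan, ρX, πX, hρX, hπX, isManinQuasiPoisson_of_restriction hι hM.toIsQuasiPoisson _ e h𝔥L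
    hρX hπX halt, isLeaf_id_of_eq_top fun x => bigDistribution_restriction_eq_top _ h𝔥L e hρX hπX
      (halt x) (hinj x) (hX.tangent x).le⟩
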